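/- Let $(M_1,\mathcal I_1)$, $(M_2,\mathcal I_2)$ be hyperbolic Monge--Ampère systems on smooth $5$-manifolds: $\mathcal I_i$ is locally generated by a contact form $\vartheta_i$, by $d\vartheta_i$ and by a further $2$-form $\Psi_i$, and $(\mu\, d\vartheta_i+\nu\Psi_i)^2\equiv 0 \bmod \vartheta_i$ has two independent real roots. Let $\mathcal C_{i1},\mathcal C_{i2}$ be the two Monge characteristic systems of $\mathcal I_i$, each spanned by $\vartheta_i$ and the factors of one of the two decomposable $2$-forms of $\mathcal I_i$. Let $P^7\subset M_1\times M_2\times\mathbb R$ be a parametric Bäcklund transformation with projections $\pi_1,\pi_2$ and parameter $\lambda$, $d\lambda\neq0$: on each slice $\lambda=\mathrm{const}$, $\pi_1$ and $\pi_2$ are submersions and, for suitable generators, $\{\Psi_1,\Psi_2\}\equiv\{d\vartheta_1,d\vartheta_2\}\bmod \vartheta_1,\vartheta_2$ with $d\vartheta_1,d\vartheta_2$ independent. Number the characteristic systems so that $\mathcal C_{11}\equiv\mathcal C_{21}$ and $\mathcal C_{12}\equiv\mathcal C_{22}$ modulo $\vartheta_1,\vartheta_2,d\lambda$. An adapted coframe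 on an open subset of $P$ is a smooth coframe $(\zeta,\theta_1,\theta_2,\omega^1,\omega^2,\omega^3,\omega^4)$ such that $\zeta$ vanishes on the slices $\lambda=\mathrm{const}$ and $d\zeta\equiv0\bmod\zeta$; $\theta_i$ spans the pullback of the line generated by $\vartheta_i$; and, for functions $A_i$, $D_i$ with $A_1A_2\ne1$, $$d\theta_1\equiv A_1\,\omega^1\wedge\omega^2+\omega^3\wedge\omega^4+\zeta\wedge(D_3\omega^3+D_4\omega^4)\bmod\theta_1,$$ $$d\theta_2\equiv \omega^1\wedge\omega^2+A_2\,\omega^3\wedge\omega^4+\zeta\wedge(D_1\omega^1+D_2\omega^2)\bmod\theta_2,$$ $$\pi_1^*\mathcal C_{11}=\{\theta_1,\omega^1,\omega^2\},\quad \pi_2^*\mathcal C_{22}=\{\theta_2,\omega^3,\omega^4\},$$ $$\pi_1^*\mathcal C_{12}=\{\theta_1,\omega^3+D_4\zeta,\omega^4-D_3\zeta\},\quad \pi_2^*\mathcal C_{21}=\{\theta_2,\omega^1+D_2\zeta,\omega^2-D_1\zeta\}.$$ Let $B_i,C_i,E_i$ be the coefficients in the structure equations $$d\omega^i\equiv B_i\,\theta_1\wedge\theta_2+C_i\,(\omega^3+D_4\zeta)\wedge(\omega^4-D_3\zeta)+E_i\,\zeta\wedge\theta_1\bmod\omega^1,\omega^2\quad(i=1,2),$$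 $$d\omega^i\equiv B_i\,\theta_1\wedge\theta_2+C_i\,(\omega^1+D_2\zeta)\wedge(\omega^2-D_1\zeta)+E_i\,\zeta\wedge\theta_2\bmod\omega^3,\omega^4\quad(i=3,4);$$ that is, for $i=1,2$ (resp. $i=3,4$) they are the coefficients of $\theta_1\wedge\theta_2$, $\omega^3\wedge\omega^4$, $\zeta\wedge\theta_1$ (resp. $\theta_1\wedge\theta_2$, $\omega^1\wedge\omega^2$, $\zeta\wedge\theta_2$) in the expansion of $d\omega^i$ in the coframe. Let $W\subset P$ be open (for instance $W=P$). Suppose that every point of $W$ has a neighbourhood with an adapted coframe for which, at each point of the neighbourhood, $[D_1\ D_2]$ is perpendicular to each of $[B_1\ B_2]$, $[C_1\ C_2]$, $[E_1\ E_2]$, at least two of these three vectors are nonzero, and, if $[D_1\ D_2]=0$ at that point, any two of these three vectors are linearly dependent there (this is automatic where $[D_1\ D_2]\neq0$). Then on $W$ the intersection $\pi_1^*\mathcal C_{11}\cap\pi_2^*\mathcal C_{21}$ contains a one-dimensional integrable subsystem, i.e. a line subbundle of $T^*W$ that is locally spanned by a smooth nowhere zero $1$-form $\eta$ with $d\eta\equiv0\bmod\eta$.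 The same conditions on $[B_3\ B_4]$, $[C_3\ C_4]$, $[D_3\ D_4]$, $[E_3\ E_4]$ imply that, on $W$, $\pi_1^*\mathcal C_{12}\cap\pi_2^*\mathcal C_{22}$ contains a one-dimensional integrable subsystem. -/

import Mathlib

open scoped Manifold ContDiff

noncomputable section

namespace Backlund

/-! ### Differential forms of degree one and two on an `n`-manifold -/

/-- The cotangent space of an `n`-manifold at a point. -/
abbrev Cotangent (n : ℕ) {M : Type*} [TopologicalSpace M]
    [ChartedSpace (EuclideanSpace ℝ (Fin n)) M] (p : M) : Type :=
  TangentSpace (𝓡 n) p →L[ℝ] ℝ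

/-- Bilinear forms on the tangent space at a point; the values of two-forms are the alternating
ones. -/
abbrev Bilin (n : ℕ) {M : Type*} [TopologicalSpace M]
    [ChartedSpace (EuclideanSpace ℝ (Fin n)) M] (p : M) : Type :=
  LinearMap.BilinForm ℝ (TangentSpace (𝓡 n) p)

/-- (Not necessarily smooth) one-forms. -/
abbrev OneForm (n : ℕ) (M : Type*) [TopologicalSpace M]
    [ChartedSpace (EuclideanSpace ℝ (Fin n)) M] : Type _ :=
  ∀ p : M, Cotangent n p

/-- (Not necessarily smooth or alternating) fields of bilinear forms. -/
abbrev BilinField (n : ℕ) (M : Type*) [TopologicalSpace M]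
    [ChartedSpace (EuclideanSpace ℝ (Fin n)) M] : Type _ :=
  ∀ p : M, Bilin n p

section Forms

variable {n : ℕ} {M : Type*} [TopologicalSpace M] [ChartedSpace (EuclideanSpace ℝ (Fin n)) M]

/-- The coordinate expression of a one-form in the preferred chart at `x`: the pullback of the
form under the inverse of the chart. -/
def OneForm.inChart (η : OneForm n M) (x : M) (y : EuclideanSpace ℝ (Fin n)) :
    EuclideanSpace ℝ (Fin n) →L[ℝ] ℝ :=
  (η ((extChartAt (𝓡 n) x).symm y)).comp
    (mfderiv 𝓘(ℝ, EuclideanSpace ℝ (Fin n)) (𝓡 n) (extChartAt (𝓡 n) x).symm y)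

/-- A one-form is smooth on an open set: near each of its points the coordinate expression
is smooth. -/
def OneForm.SmoothOn (η : OneForm n M) (U : Set M) : Prop :=
  ∀ p ∈ U, ContDiffAt ℝ ∞ (OneForm.inChart η p) (extChartAt (𝓡 n) p p)

/-- A field of bilinear forms is smooth on an open set: near each of its points all components of
the coordinate expression are smooth. -/
def BilinField.SmoothOn (Φ : BilinField n M) (U : Set M) : Prop :=
  ∀ p ∈ U, ∀ u v : EuclideanSpace ℝ (Fin n),
    ContDiffAt ℝ ∞
      (fun y => Φ ((extChartAt (𝓡 n) p).symm y)
        (mfderiv 𝓘(ℝ, EuclideanSpace ℝ (Fin n)) (𝓡 n) (extChartAt (𝓡 n) p).symm y u)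
        (mfderiv 𝓘(ℝ, EuclideanSpace ℝ (Fin n)) (𝓡 n) (extChartAt (𝓡 n) p).symm y v))
      (extChartAt (𝓡 n) p p)

/-- Twice the alternation of a bilinear map: `(u, v) ↦ L u v - L v u`. -/
def skew {E : Type*} [NormedAddCommGroup E] [NormedSpace ℝ E] (L : E →L[ℝ] E →L[ℝ] ℝ) :
    LinearMap.BilinForm ℝ E :=
  LinearMap.mk₂ ℝ (fun u v => L u v - L v u)
    (by intro u u' v; simp; ring) (by intro c u v; simp; ring)
    (by intro u v v'; simp; ring) (by intro c u v; simp; ring)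

/-- The exterior derivative of a one-form, computed at `p` in the preferred chart at `p` (whose
differential at `p` is the identity of the tangent space at `p`):
`dη(u, v) = ∂ᵤ(η(v)) - ∂ᵥ(η(u))` for constant `u, v`. -/
def OneForm.d (η : OneForm n M) : BilinField n M := fun p =>
  skew (fderiv ℝ (OneForm.inChart η p) (extChartAt (𝓡 n) p p))

end Forms

/-! ### Linear algebra of forms at a point -/

section Linear

variable {V : Type*} [AddCommGroup V] [Module ℝ V] [TopologicalSpace V]

/-- The wedge product of two covectors. -/
def wedge (a b : V →L[ℝ] ℝ) : LinearMap.BilinForm ℝ V :=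
  LinearMap.mk₂ ℝ (fun u v => a u * b v - a v * b u)
    (by intro u u' v; simp; ring) (by intro c u v; simp; ring)
    (by intro u v v'; simp; ring) (by intro c u v; simp; ring)

/-- The square `Φ ∧ Φ` of a two-form, a four-form. -/
def wedgeSq (Φ : LinearMap.BilinForm ℝ V) (v₁ v₂ v₃ v₄ : V) : ℝ :=
  2 * (Φ v₁ v₂ * Φ v₃ v₄ - Φ v₁ v₃ * Φ v₂ v₄ + Φ v₁ v₄ * Φ v₂ v₃)

/-- The five-form `θ ∧ Φ ∧ Φ`. -/
def wedgeOneSq (θ : V →L[ℝ] ℝ) (Φ : LinearMap.BilinForm ℝ V) (v₀ v₁ v₂ v₃ v₄ : V) : ℝ :=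
  θ v₀ * wedgeSq Φ v₁ v₂ v₃ v₄ - θ v₁ * wedgeSq Φ v₀ v₂ v₃ v₄ + θ v₂ * wedgeSq Φ v₀ v₁ v₃ v₄
    - θ v₃ * wedgeSq Φ v₀ v₁ v₂ v₄ + θ v₄ * wedgeSq Φ v₀ v₁ v₂ v₃

/-- The two-forms `∑ βᵢ ∧ αᵢ` with `αᵢ ∈ L`. -/
def wedgeIdeal (L : Submodule ℝ (V →L[ℝ] ℝ)) : Submodule ℝ (LinearMap.BilinForm ℝ V) :=
  Submodule.span ℝ {Φ | ∃ α ∈ L, ∃ β : V →L[ℝ] ℝ, Φ = wedge β α}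

/-- `Φ ≡ Φ'` modulo `θ`. -/
def CongrMod (θ : V →L[ℝ] ℝ) (Φ Φ' : LinearMap.BilinForm ℝ V) : Prop :=
  Φ - Φ' ∈ wedgeIdeal (Submodule.span ℝ {θ})

/-- `Φ ∧ Φ ≡ 0` modulo `θ`, i.e. `Φ ∧ Φ` vanishes on the kernel of `θ`. -/
def SqZeroMod (θ : V →L[ℝ] ℝ) (Φ : LinearMap.BilinForm ℝ V) : Prop :=
  ∀ v₁ v₂ v₃ v₄ : V, θ v₁ = 0 → θ v₂ = 0 → θ v₃ = 0 → θ v₄ = 0 → wedgeSq Φ v₁ v₂ v₃ v₄ = 0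

end Linear

/-! ### Pfaffian systems -/

section Pfaffian

variable {n : ℕ} {M : Type*} [TopologicalSpace M] [ChartedSpace (EuclideanSpace ℝ (Fin n)) M]

/-- `η₀, …, η_{k-1}` are smooth one-forms on `U` that form a basis of the system `C` at each point
of `U`. -/
def IsLocalBasis {k : ℕ} (C : ∀ p : M, Submodule ℝ (Cotangent n p)) (U : Set M)
    (η : Fin k → OneForm n M) : Prop :=
  (∀ i, OneForm.SmoothOn (η i) U) ∧
    ∀ q ∈ U, LinearIndependent ℝ (fun i => η i q) ∧
      C q = Submodule.span ℝ (Set.range fun i => η i q)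

/-- A Pfaffian system of rank `k`: a smooth rank `k` subbundle of the cotangent bundle. -/
def IsPfaffian (k : ℕ) (C : ∀ p : M, Submodule ℝ (Cotangent n p)) : Prop :=
  ∀ p : M, ∃ U : Set M, IsOpen U ∧ p ∈ U ∧ ∃ η : Fin k → OneForm n M, IsLocalBasis C U η

/-- `η` is integrable on `U`: `dη ≡ 0` modulo `η`. -/
def IntegrableOn (η : OneForm n M) (U : Set M) : Prop :=
  ∀ q ∈ U, CongrMod (η q) (OneForm.d η q) 0

/-- On the open set `W`, the system `C` contains a one-dimensional integrable subsystem: a line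
subbundle `ℓ` of the cotangent bundle of `W`, contained in `C`, that is locally spanned by a smooth
nowhere zero integrable one-form. -/
def ContainsIntegrableLine (C : ∀ p : M, Submodule ℝ (Cotangent n p)) (W : Set M) : Prop :=
  ∃ ℓ : ∀ p : M, Submodule ℝ (Cotangent n p),
    (∀ p ∈ W, ℓ p ≤ C p) ∧
    ∀ p ∈ W, ∃ U : Set M, IsOpen U ∧ p ∈ U ∧ U ⊆ W ∧ ∃ η : OneForm n M,
      OneForm.SmoothOn η U ∧ IntegrableOn η U ∧
        ∀ q ∈ U, η q ≠ 0 ∧ ℓ q = Submodule.span ℝ {η q}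

end Pfaffian

/-! ### Hyperbolic Monge-Ampère systems -/

section MongeAmpere

variable {M : Type*} [TopologicalSpace M] [ChartedSpace (EuclideanSpace ℝ (Fin 5)) M]

/-- On `U`, the contact form `θ`, its derivative `dθ` and the two-form `Ψ` generate an ideal whose
homogeneous parts of degree one and two are `one` and `two`; moreover `Ψ` is independent of `dθ`
and of the wedge products involving `θ`. -/
structure Generates (one : ∀ p : M, Submodule ℝ (Cotangent 5 p))
    (two : ∀ p : M, Submodule ℝ (Bilin 5 p)) (U : Set M)
    (θ : OneForm 5 M) (Ψ : BilinField 5 M) : Prop where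
  smooth_theta : OneForm.SmoothOn θ U
  smooth_psi : BilinField.SmoothOn Ψ U
  alternating_psi : ∀ q ∈ U, (Ψ q).IsAlt
  contact : ∀ q ∈ U, ∃ v₀ v₁ v₂ v₃ v₄ : TangentSpace (𝓡 5) q,
    wedgeOneSq (θ q) (OneForm.d θ q) v₀ v₁ v₂ v₃ v₄ ≠ 0
  independent : ∀ q ∈ U,
    Ψ q ∉ Submodule.span ℝ {OneForm.d θ q} ⊔ wedgeIdeal (Submodule.span ℝ {θ q})
  one_eq : ∀ q ∈ U, one q = Submodule.span ℝ {θ q}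
  two_eq : ∀ q ∈ U, two q =
    Submodule.span ℝ {OneForm.d θ q, Ψ q} ⊔ wedgeIdeal (Submodule.span ℝ {θ q})

variable (M) in
/-- A Monge-Ampère system on a five-manifold. The ideal is algebraically generated by forms of
degree one and two, hence it is given by its homogeneous parts `one` and `two` of these degrees. (It
is automatically differentially closed: since `dθ` is nondegenerate on the kernel of `θ`, every
three-form lies in the ideal generated by `θ` and `dθ`.) -/
structure MongeAmpereSystem where
  one : ∀ p : M, Submodule ℝ (Cotangent 5 p)
  two : ∀ p : M, Submodule ℝ (Bilin 5 p)
  locally_generated : ∀ p : M, ∃ U : Set M, IsOpen U ∧ p ∈ U ∧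
    ∃ (θ : OneForm 5 M) (Ψ : BilinField 5 M), Generates one two U θ Ψ

/-- Hyperbolicity: the equation `(μ dθ + ν Ψ)² ≡ 0 mod θ` has two linearly independent real
roots. -/
def MongeAmpereSystem.IsHyperbolic (I : MongeAmpereSystem M) : Prop :=
  ∀ (U : Set M) (θ : OneForm 5 M) (Ψ : BilinField 5 M), IsOpen U →
    Generates I.one I.two U θ Ψ → ∀ q ∈ U, ∃ μ ν : Fin 2 → ℝ,
      LinearIndependent ℝ (fun i => ![μ i, ν i]) ∧
        ∀ i, SqZeroMod (θ q) (μ i • OneForm.d θ q + ν i • Ψ q)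

/-- `C` is one of the Monge characteristic spaces of `I` at `p`: it is spanned by the contact form
and by the factors of a decomposable two-form of the ideal that is nonzero modulo the contact
form. -/
def MongeAmpereSystem.IsCharacteristicAt (I : MongeAmpereSystem M) (p : M)
    (C : Submodule ℝ (Cotangent 5 p)) : Prop :=
  ∃ a b : Cotangent 5 p, wedge a b ∈ I.two p ∧ wedge a b ∉ wedgeIdeal (I.one p) ∧
    C = I.one p ⊔ Submodule.span ℝ {a, b}

/-- `C₁, C₂` are the two Monge characteristic systems of `I`, in some numbering. -/
structure MongeAmpereSystem.IsCharacteristicPair (I : MongeAmpereSystem M)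
    (C₁ C₂ : ∀ p : M, Submodule ℝ (Cotangent 5 p)) : Prop where
  pfaffian_fst : IsPfaffian 3 C₁
  pfaffian_snd : IsPfaffian 3 C₂
  characteristic_fst : ∀ p, I.IsCharacteristicAt p (C₁ p)
  characteristic_snd : ∀ p, I.IsCharacteristicAt p (C₂ p)
  distinct : ∀ p, C₁ p ≠ C₂ p

end MongeAmpere

/-! ### Pullbacks -/

section Pullback

variable {m n : ℕ} {N : Type*} [TopologicalSpace N] [ChartedSpace (EuclideanSpace ℝ (Fin m)) N]
  {M : Type*} [TopologicalSpace M] [ChartedSpace (EuclideanSpace ℝ (Fin n)) M]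

/-- Pullback of covectors under the differential of `f` at `p`. -/
def pullOne (f : N → M) (p : N) : Cotangent n (f p) →ₗ[ℝ] Cotangent m p where
  toFun α := α.comp (mfderiv (𝓡 m) (𝓡 n) f p)
  map_add' _ _ := rfl
  map_smul' _ _ := rfl

/-- Pullback of bilinear forms under the differential of `f` at `p`. -/
def pullTwo (f : N → M) (p : N) (Φ : Bilin n (f p)) : Bilin m p :=
  LinearMap.BilinForm.comp Φ
    (mfderiv (𝓡 m) (𝓡 n) f p).toLinearMap (mfderiv (𝓡 m) (𝓡 n) f p).toLinearMap

/-- Pullback of a system of one-forms. -/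
def pullSystem (f : N → M) (C : ∀ x : M, Submodule ℝ (Cotangent n x)) (p : N) :
    Submodule ℝ (Cotangent m p) :=
  (C (f p)).map (pullOne f p)

/-- The differential of a function. -/
def dFun (g : N → ℝ) : OneForm m N := fun p => mfderiv (𝓡 m) 𝓘(ℝ, ℝ) g p

end Pullback

/-! ### Parametric Bäcklund transformations -/

/-- A parametric Bäcklund transformation between two hyperbolic Monge-Ampère systems, together with
the numbering of the characteristic systems. The seven-manifold `P` is an embedded submanifold of
`M₁ × M₂ × ℝ` through `p ↦ (π₁ p, π₂ p, lam p)`. The slices of constant `lam` have the tangent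
spaces `ker d(lam)`, and each of them is a Bäcklund transformation. -/
structure ParametricBacklund (M₁ M₂ P : Type*)
    [TopologicalSpace M₁] [ChartedSpace (EuclideanSpace ℝ (Fin 5)) M₁] [IsManifold (𝓡 5) ∞ M₁]
    [TopologicalSpace M₂] [ChartedSpace (EuclideanSpace ℝ (Fin 5)) M₂] [IsManifold (𝓡 5) ∞ M₂]
    [TopologicalSpace P] [ChartedSpace (EuclideanSpace ℝ (Fin 7)) P] [IsManifold (𝓡 7) ∞ P] where
  I₁ : MongeAmpereSystem M₁
  I₂ : MongeAmpereSystem M₂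
  hyperbolic₁ : I₁.IsHyperbolic
  hyperbolic₂ : I₂.IsHyperbolic
  C₁₁ : ∀ p : M₁, Submodule ℝ (Cotangent 5 p)
  C₁₂ : ∀ p : M₁, Submodule ℝ (Cotangent 5 p)
  C₂₁ : ∀ p : M₂, Submodule ℝ (Cotangent 5 p)
  C₂₂ : ∀ p : M₂, Submodule ℝ (Cotangent 5 p)
  characteristic₁ : I₁.IsCharacteristicPair C₁₁ C₁₂
  characteristic₂ : I₂.IsCharacteristicPair C₂₁ C₂₂
  π₁ : P → M₁
  π₂ : P → M₂
  lam : P → ℝ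
  smooth_π₁ : ContMDiff (𝓡 7) (𝓡 5) ∞ π₁
  smooth_π₂ : ContMDiff (𝓡 7) (𝓡 5) ∞ π₂
  smooth_lam : ContMDiff (𝓡 7) 𝓘(ℝ, ℝ) ∞ lam
  isEmbedding : Topology.IsEmbedding fun p => (π₁ p, π₂ p, lam p)
  immersion : ∀ (p : P) (v : TangentSpace (𝓡 7) p), mfderiv (𝓡 7) (𝓡 5) π₁ p v = 0 →
    mfderiv (𝓡 7) (𝓡 5) π₂ p v = 0 → dFun (m := 7) lam p v = 0 → v = 0
  dlam_ne_zero : ∀ p : P, dFun (m := 7) lam p ≠ 0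
  /-- The projection of each slice to `M₁` is a submersion. -/
  submersion₁ : ∀ (p : P) (w : TangentSpace (𝓡 5) (π₁ p)),
    ∃ v : TangentSpace (𝓡 7) p, dFun (m := 7) lam p v = 0 ∧ mfderiv (𝓡 7) (𝓡 5) π₁ p v = w
  /-- The projection of each slice to `M₂` is a submersion. -/
  submersion₂ : ∀ (p : P) (w : TangentSpace (𝓡 5) (π₂ p)),
    ∃ v : TangentSpace (𝓡 7) p, dFun (m := 7) lam p v = 0 ∧ mfderiv (𝓡 7) (𝓡 5) π₂ p v = w
  /-- On each slice, for suitable generators of the two systems, `{Ψ₁, Ψ₂} ≡ {dθ₁, dθ₂}` modulo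
  `θ₁, θ₂`, with `dθ₁, dθ₂` linearly independent; the forms are restricted to the common kernel `H`
  of `θ₁`, `θ₂` in the tangent space of the slice. -/
  backlund : ∀ p : P,
    ∃ (U₁ : Set M₁) (θ₁ : OneForm 5 M₁) (Ψ₁ : BilinField 5 M₁)
      (U₂ : Set M₂) (θ₂ : OneForm 5 M₂) (Ψ₂ : BilinField 5 M₂),
      IsOpen U₁ ∧ π₁ p ∈ U₁ ∧ Generates I₁.one I₁.two U₁ θ₁ Ψ₁ ∧
      IsOpen U₂ ∧ π₂ p ∈ U₂ ∧ Generates I₂.one I₂.two U₂ θ₂ Ψ₂ ∧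
      ∃ H : Submodule ℝ (TangentSpace (𝓡 7) p),
        (∀ v, v ∈ H ↔ dFun (m := 7) lam p v = 0 ∧ pullOne π₁ p (θ₁ (π₁ p)) v = 0 ∧
          pullOne π₂ p (θ₂ (π₂ p)) v = 0) ∧
        Submodule.span ℝ {(pullTwo π₁ p (Ψ₁ (π₁ p))).restrict H,
            (pullTwo π₂ p (Ψ₂ (π₂ p))).restrict H} =
          Submodule.span ℝ {(pullTwo π₁ p (OneForm.d θ₁ (π₁ p))).restrict H,
            (pullTwo π₂ p (OneForm.d θ₂ (π₂ p))).restrict H} ∧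
        LinearIndependent ℝ ![(pullTwo π₁ p (OneForm.d θ₁ (π₁ p))).restrict H,
            (pullTwo π₂ p (OneForm.d θ₂ (π₂ p))).restrict H]
  /-- The numbering: `C₁₁ ≡ C₂₁` modulo `θ₁, θ₂, d(lam)`. -/
  numbering_fst : ∀ p : P,
    pullSystem π₁ C₁₁ p ⊔ (pullSystem π₁ I₁.one p ⊔ pullSystem π₂ I₂.one p ⊔
        Submodule.span ℝ {dFun (m := 7) lam p}) =
      pullSystem π₂ C₂₁ p ⊔ (pullSystem π₁ I₁.one p ⊔ pullSystem π₂ I₂.one p ⊔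
        Submodule.span ℝ {dFun (m := 7) lam p})
  /-- The numbering: `C₁₂ ≡ C₂₂` modulo `θ₁, θ₂, d(lam)`. -/
  numbering_snd : ∀ p : P,
    pullSystem π₁ C₁₂ p ⊔ (pullSystem π₁ I₁.one p ⊔ pullSystem π₂ I₂.one p ⊔
        Submodule.span ℝ {dFun (m := 7) lam p}) =
      pullSystem π₂ C₂₂ p ⊔ (pullSystem π₁ I₁.one p ⊔ pullSystem π₂ I₂.one p ⊔
        Submodule.span ℝ {dFun (m := 7) lam p})

section GStructure

variable {M₁ M₂ P : Type*}
  [TopologicalSpace M₁] [ChartedSpace (EuclideanSpace ℝ (Fin 5)) M₁] [IsManifold (𝓡 5) ∞ M₁]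
  [TopologicalSpace M₂] [ChartedSpace (EuclideanSpace ℝ (Fin 5)) M₂] [IsManifold (𝓡 5) ∞ M₂]
  [TopologicalSpace P] [ChartedSpace (EuclideanSpace ℝ (Fin 7)) P] [IsManifold (𝓡 7) ∞ P]

/-- An adapted coframe on an open set `dom`, i.e. a local section of the canonical `G`-structure of
the transformation `T`. The functions `A i`, `D i` are the ones determined by the coframe, and
`frame` is the frame dual to `(ζ, θ₁, θ₂, ω₁, ω₂, ω₃, ω₄)`. -/
structure AdaptedCoframe (T : ParametricBacklund M₁ M₂ P) where
  dom : Set P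
  isOpen_dom : IsOpen dom
  ζ : OneForm 7 P
  θ₁ : OneForm 7 P
  θ₂ : OneForm 7 P
  ω₁ : OneForm 7 P
  ω₂ : OneForm 7 P
  ω₃ : OneForm 7 P
  ω₄ : OneForm 7 P
  smooth : ∀ i, OneForm.SmoothOn (![ζ, θ₁, θ₂, ω₁, ω₂, ω₃, ω₄] i) dom
  frame : Fin 7 → ∀ q : P, TangentSpace (𝓡 7) q
  dual : ∀ q ∈ dom, ∀ i j,
    ![ζ, θ₁, θ₂, ω₁, ω₂, ω₃, ω₄] i q (frame j q) = if i = j then 1 else 0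
  A₁ : P → ℝ
  A₂ : P → ℝ
  D₁ : P → ℝ
  D₂ : P → ℝ
  D₃ : P → ℝ
  D₄ : P → ℝ
  /-- `ζ` vanishes on the slices of constant `lam`. -/
  zeta_slice : ∀ q ∈ dom, ∀ v : TangentSpace (𝓡 7) q, dFun (m := 7) T.lam q v = 0 → ζ q v = 0
  zeta_integrable : IntegrableOn ζ dom
  theta₁_contact : ∀ q ∈ dom, pullSystem T.π₁ T.I₁.one q = Submodule.span ℝ {θ₁ q}
  theta₂_contact : ∀ q ∈ dom, pullSystem T.π₂ T.I₂.one q = Submodule.span ℝ {θ₂ q}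
  char₁₁ : ∀ q ∈ dom, pullSystem T.π₁ T.C₁₁ q = Submodule.span ℝ {θ₁ q, ω₁ q, ω₂ q}
  char₂₂ : ∀ q ∈ dom, pullSystem T.π₂ T.C₂₂ q = Submodule.span ℝ {θ₂ q, ω₃ q, ω₄ q}
  char₁₂ : ∀ q ∈ dom, pullSystem T.π₁ T.C₁₂ q =
    Submodule.span ℝ {θ₁ q, ω₃ q + D₄ q • ζ q, ω₄ q - D₃ q • ζ q}
  char₂₁ : ∀ q ∈ dom, pullSystem T.π₂ T.C₂₁ q =
    Submodule.span ℝ {θ₂ q, ω₁ q + D₂ q • ζ q, ω₂ q - D₁ q • ζ q}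
  dtheta₁ : ∀ q ∈ dom, CongrMod (θ₁ q) (OneForm.d θ₁ q)
    (A₁ q • wedge (ω₁ q) (ω₂ q) + wedge (ω₃ q) (ω₄ q)
      + wedge (ζ q) (D₃ q • ω₃ q + D₄ q • ω₄ q))
  dtheta₂ : ∀ q ∈ dom, CongrMod (θ₂ q) (OneForm.d θ₂ q)
    (wedge (ω₁ q) (ω₂ q) + A₂ q • wedge (ω₃ q) (ω₄ q)
      + wedge (ζ q) (D₁ q • ω₁ q + D₂ q • ω₂ q))
  A_mul_ne_one : ∀ q ∈ dom, A₁ q * A₂ q ≠ 1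

namespace AdaptedCoframe

variable {T : ParametricBacklund M₁ M₂ P} (σ : AdaptedCoframe T)

/-- The coefficient of the wedge product of the `i`-th and the `j`-th form of the coframe
`(ζ, θ₁, θ₂, ω₁, ω₂, ω₃, ω₄)`, numbered from zero, in `dη`. -/
def coeff (η : OneForm 7 P) (i j : Fin 7) (q : P) : ℝ :=
  OneForm.d η q (σ.frame i q) (σ.frame j q)

/-- `[B₁ B₂]`: the coefficients of `θ₁ ∧ θ₂` in `dω₁`, `dω₂`. Here and below, the coefficients
are those of the structure equations
`dωᵢ ≡ Bᵢ θ₁ ∧ θ₂ + Cᵢ (ω₃ + D₄ ζ) ∧ (ω₄ - D₃ ζ) + Eᵢ ζ ∧ θ₁ mod ω₁, ω₂` for `i = 1, 2` and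
`dωᵢ ≡ Bᵢ θ₁ ∧ θ₂ + Cᵢ (ω₁ + D₂ ζ) ∧ (ω₂ - D₁ ζ) + Eᵢ ζ ∧ θ₂ mod ω₃, ω₄` for `i = 3, 4`. -/
def vecB₁₂ (q : P) : Fin 2 → ℝ := ![σ.coeff σ.ω₁ 1 2 q, σ.coeff σ.ω₂ 1 2 q]

/-- `[C₁ C₂]`: the coefficients of `ω₃ ∧ ω₄` in `dω₁`, `dω₂`. -/
def vecC₁₂ (q : P) : Fin 2 → ℝ := ![σ.coeff σ.ω₁ 5 6 q, σ.coeff σ.ω₂ 5 6 q]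

/-- `[E₁ E₂]`: the coefficients of `ζ ∧ θ₁` in `dω₁`, `dω₂`. -/
def vecE₁₂ (q : P) : Fin 2 → ℝ := ![σ.coeff σ.ω₁ 0 1 q, σ.coeff σ.ω₂ 0 1 q]

/-- `[D₁ D₂]`. -/
def vecD₁₂ (q : P) : Fin 2 → ℝ := ![σ.D₁ q, σ.D₂ q]

/-- `[B₃ B₄]`: the coefficients of `θ₁ ∧ θ₂` in `dω₃`, `dω₄`. -/
def vecB₃₄ (q : P) : Fin 2 → ℝ := ![σ.coeff σ.ω₃ 1 2 q, σ.coeff σ.ω₄ 1 2 q]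

/-- `[C₃ C₄]`: the coefficients of `ω₁ ∧ ω₂` in `dω₃`, `dω₄`. -/
def vecC₃₄ (q : P) : Fin 2 → ℝ := ![σ.coeff σ.ω₃ 3 4 q, σ.coeff σ.ω₄ 3 4 q]

/-- `[E₃ E₄]`: the coefficients of `ζ ∧ θ₂` in `dω₃`, `dω₄`. -/
def vecE₃₄ (q : P) : Fin 2 → ℝ := ![σ.coeff σ.ω₃ 0 2 q, σ.coeff σ.ω₄ 0 2 q]

/-- `[D₃ D₄]`. -/
def vecD₃₄ (q : P) : Fin 2 → ℝ := ![σ.D₃ q, σ.D₄ q]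

end AdaptedCoframe

end GStructure

/-- The vector `D` is perpendicular to each of `B`, `C`, `E`, at least two of which are nonzero; and
if `D = 0`, then any two of `B`, `C`, `E` are linearly dependent (if `D ≠ 0` this is automatic). -/
structure PerpCondition (B C D E : Fin 2 → ℝ) : Prop where
  perp_B : D ⬝ᵥ B = 0
  perp_C : D ⬝ᵥ C = 0
  perp_E : D ⬝ᵥ E = 0
  two_ne_zero : (B ≠ 0 ∧ C ≠ 0) ∨ (B ≠ 0 ∧ E ≠ 0) ∨ (C ≠ 0 ∧ E ≠ 0)
  dependent : D = 0 → ¬ LinearIndependent ℝ ![B, C] ∧ ¬ LinearIndependent ℝ ![B, E] ∧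
    ¬ LinearIndependent ℝ ![C, E]

end Backlund

end

/-! Write B, C, D, E for the vectors with indices 1, 2. Since two of B, C, E are nonzero, B or E is
nonzero at a given point; call that vector (x, y) and put η = y ω₁ - x ω₂ (`perpForm`). The
condition D ⟂ (x, y) cancels the ζ-terms, so η lies in both pulled back systems (`perpForm_mem`).

The structure equations (`coeffs_omega`) say that modulo ω₁, ω₂ only B, C, E enter dω₁ and dω₂. They
are vectors in the plane and pairwise parallel, so where (x, y) ≠ 0 the forms dω₁ and dω₂ are
congruent to x Ω and y Ω for a single two-form Ω. Hence dη ≡ 0 mod ω₁, ω₂ (`d_perpForm_apply`), say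
dη = ω₁ ∧ α₁ + ω₂ ∧ α₂. Now d(dη) = 0 gives Ω ∧ (x α₁ + y α₂) ≡ 0 mod ω₁, ω₂. Where C ≠ 0, the form
Ω has rank four, because B or E is also nonzero; then x α₁ + y α₂ ≡ 0 mod ω₁, ω₂
(`coeffs_dotProduct_d_perpForm`), which is the missing part of dη ≡ 0 mod η.

Where C = 0, Ω is decomposable and this argument fails. But C cannot vanish on an open set
(`not_eventually_coeffs_eq_zero`): otherwise dω₁, dω₂ ≡ 0 mod θ₁, ω₁, ω₂ there, and since dθ₁
contains ω₃ ∧ ω₄, d² = 0 would force B = E = 0. The identity therefore extends by continuity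
(`d_perpForm_mixed`, `congrMod_perpForm`).

The form η depends on the coframe, and the coframe is only local. The span of ω₁, ω₂ does not depend
on it, being π₁*C₁₁ ∩ (π₂*C₂₁ + dλ) (`commonSystem_eq`), and η spans the derived system of this span
(`derivedSystem_eq`). So the local lines agree on overlaps. The second assertion is the first one
for the transformation with M₁ and M₂ interchanged. -/

noncomputable section

namespace Backlund

/-! ### Exterior derivatives of one-forms on normed spaces -/

section Flat

variable {E F : Type*} [NormedAddCommGroup E] [NormedSpace ℝ E]
  [NormedAddCommGroup F] [NormedSpace ℝ F]

/-- The exterior derivative of a one-form on a normed space. -/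
def dFlat (α : E → E →L[ℝ] ℝ) (y : E) : LinearMap.BilinForm ℝ E := skew (fderiv ℝ α y)

lemma dFlat_apply (α : E → E →L[ℝ] ℝ) (y u v : E) :
    dFlat α y u v = fderiv ℝ α y u v - fderiv ℝ α y v u := rfl

lemma dFlat_swap (α : E → E →L[ℝ] ℝ) (y u v : E) : dFlat α y u v = -dFlat α y v u := by
  simp [dFlat_apply]

lemma dFlat_self (α : E → E →L[ℝ] ℝ) (y u : E) : dFlat α y u u = 0 := by
  simp [dFlat_apply]

lemma dFlat_congr {α β : E → E →L[ℝ] ℝ} {y : E} (h : α =ᶠ[nhds y] β) :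
    dFlat α y = dFlat β y := by
  unfold dFlat; rw [h.fderiv_eq]

/-- The exterior derivative commutes with pullback. -/
lemma dFlat_pullback {f : E → F} {α : F → F →L[ℝ] ℝ} {y : E} (hf : ContDiffAt ℝ 2 f y)
    (hα : DifferentiableAt ℝ α (f y)) (u v : E) :
    dFlat (fun z => (α (f z)).comp (fderiv ℝ f z)) y u v =
      dFlat α (f y) (fderiv ℝ f y u) (fderiv ℝ f y v) := by
  have hf1 : DifferentiableAt ℝ f y := hf.differentiableAt (by norm_num)
  have hf2 : DifferentiableAt ℝ (fderiv ℝ f) y :=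
    (hf.fderiv_right (m := 1) (by norm_num)).differentiableAt (by norm_num)
  -- The product rule produces the extra term α(D²f(u, v)), which is symmetric in u, v and cancels
  -- in the alternation.
  have hs : IsSymmSndFDerivAt ℝ f y := hf.isSymmSndFDerivAt (by simp)
  have hαf : HasFDerivAt (fun z => α (f z)) ((fderiv ℝ α (f y)).comp (fderiv ℝ f y)) y :=
    hα.hasFDerivAt.comp y hf1.hasFDerivAt
  have key := (hαf.clm_comp hf2.hasFDerivAt).fderiv
  have := hs.eq u v
  simp [dFlat_apply, key, this]

/-- Linear combinations of one-forms with variable coefficients: on the common kernel of the forms,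
the coefficients are not differentiated. -/
lemma dFlat_sum_smul {ι : Type*} (s : Finset ι) {f : ι → E → ℝ} {τ : ι → E → E →L[ℝ] ℝ} {y : E}
    (hf : ∀ i ∈ s, DifferentiableAt ℝ (f i) y) (hτ : ∀ i ∈ s, DifferentiableAt ℝ (τ i) y)
    {u v : E} (hu : ∀ i ∈ s, τ i y u = 0) (hv : ∀ i ∈ s, τ i y v = 0) :
    dFlat (fun z => ∑ i ∈ s, f i z • τ i z) y u v = ∑ i ∈ s, f i y * dFlat (τ i) y u v := by
  have key : HasFDerivAt (fun z => ∑ i ∈ s, f i z • τ i z)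
      (∑ i ∈ s, (f i y • fderiv ℝ (τ i) y + (fderiv ℝ (f i) y).smulRight (τ i y))) y :=
    HasFDerivAt.fun_sum fun i hi => (hf i hi).hasFDerivAt.smul (hτ i hi).hasFDerivAt
  simp only [dFlat_apply, key.fderiv, _root_.sum_apply, ← Finset.sum_sub_distrib]
  refine Finset.sum_congr rfl fun i hi => ?_
  simp [hu i hi, hv i hi]
  ring

/-- `d(dη) = 0`. -/
lemma dFlat_cyclic {η : E → E →L[ℝ] ℝ} {y : E} (hη : ContDiffAt ℝ 2 η y) (u v w : E) :
    fderiv ℝ (fun z => dFlat η z v w) y u + fderiv ℝ (fun z => dFlat η z w u) y v +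
      fderiv ℝ (fun z => dFlat η z u v) y w = 0 := by
  have h2 : DifferentiableAt ℝ (fderiv ℝ η) y :=
    (hη.fderiv_right (m := 1) (by norm_num)).differentiableAt (by norm_num)
  have hs : IsSymmSndFDerivAt ℝ η y := hη.isSymmSndFDerivAt (by simp)
  have hd : ∀ a b c : E, fderiv ℝ (fun z => dFlat η z a b) y c =
      fderiv ℝ (fderiv ℝ η) y c a b - fderiv ℝ (fderiv ℝ η) y c b a := by
    intro a b c
    have h : ∀ a b : E, HasFDerivAt (fun z => fderiv ℝ η z a b)
        (((fderiv ℝ (fderiv ℝ η) y).flip a).flip b) y := by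
      intro a b
      have h1 := h2.hasFDerivAt.clm_apply (hasFDerivAt_const a y)
      exact (h1.clm_apply (hasFDerivAt_const b y)).congr_fderiv (by ext; simp)
    have := ((h a b).sub (h b a)).fderiv
    simp only [dFlat_apply]
    erw [this]
    simp
  simp only [hd]
  rw [hs.eq u v, hs.eq v w, hs.eq w u]
  ring

lemma contDiffAt_dFlat_apply {η : E → E →L[ℝ] ℝ} {y : E} (hη : ContDiffAt ℝ ∞ η y) {a b : E → E}
    {n : ℕ∞} (ha : ContDiffAt ℝ n a y) (hb : ContDiffAt ℝ n b y) :
    ContDiffAt ℝ n (fun z => dFlat η z (a z) (b z)) y := by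
  have h2 : ContDiffAt ℝ n (fderiv ℝ η) y := by
    refine hη.fderiv_right (m := n) ?_
    exact_mod_cast le_top
  simp only [dFlat_apply]
  exact ((h2.clm_apply ha).clm_apply hb).sub ((h2.clm_apply hb).clm_apply ha)

/-- If `dη` vanishes near `y` on the common kernel of the forms `τ i`, `i ∈ s`, so that
`dη = ∑ τ i ∧ α i`, then `∑ dτ i ∧ α i` vanishes on this kernel at `y`. -/
lemma dFlat_cyclic_of_vanishing {ι : Type*} [DecidableEq ι] (s : Finset ι)
    {τ : ι → E → E →L[ℝ] ℝ} {e : ι → E → E}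
    {η : E → E →L[ℝ] ℝ} {y : E} (hη : ContDiffAt ℝ ∞ η y)
    (hτ : ∀ i ∈ s, DifferentiableAt ℝ (τ i) y) (he : ∀ i ∈ s, DifferentiableAt ℝ (e i) y)
    (hdual : ∀ᶠ z in nhds y, ∀ i ∈ s, ∀ j ∈ s, τ i z (e j z) = if i = j then 1 else 0)
    (hvan : ∀ᶠ z in nhds y, ∀ u v : E, (∀ i ∈ s, τ i z u = 0) → (∀ i ∈ s, τ i z v = 0) →
      dFlat η z u v = 0)
    {u v w : E} (hu : ∀ i ∈ s, τ i y u = 0) (hv : ∀ i ∈ s, τ i y v = 0)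
    (hw : ∀ i ∈ s, τ i y w = 0) :
    ∑ i ∈ s, (dFlat (τ i) y u v * dFlat η y (e i y) w + dFlat (τ i) y v w * dFlat η y (e i y) u +
      dFlat (τ i) y w u * dFlat η y (e i y) v) = 0 := by
  -- the projection of a constant vector field to the kernel
  let pr : E → E → E := fun a z => a - ∑ i ∈ s, τ i z a • e i z
  have hpr : ∀ a, (∀ i ∈ s, τ i y a = 0) → HasFDerivAt (pr a)
      (-∑ i ∈ s, ((fderiv ℝ (τ i) y).flip a).smulRight (e i y)) y := by
    intro a ha
    have h : ∀ i ∈ s, HasFDerivAt (fun z => τ i z a • e i z)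
        (((fderiv ℝ (τ i) y).flip a).smulRight (e i y)) y := by
      intro i hi
      have h1 := (hτ i hi).hasFDerivAt.clm_apply (hasFDerivAt_const a y)
      have h2 := h1.smul (he i hi).hasFDerivAt
      exact h2.congr_fderiv (by ext b; simp [ha i hi])
    have := (HasFDerivAt.fun_sum h).const_sub a
    simpa [pr] using this
  have hpry : ∀ a, (∀ i ∈ s, τ i y a = 0) → pr a y = a := by
    intro a ha
    simp only [pr]
    rw [Finset.sum_eq_zero (fun i hi => by simp [ha i hi])]
    simp
  have hker : ∀ a b : E, ∀ᶠ z in nhds y, dFlat η z (pr a z) (pr b z) = 0 := by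
    intro a b
    filter_upwards [hdual, hvan] with z hz hz'
    have : ∀ a, ∀ i ∈ s, τ i z (pr a z) = 0 := by
      intro a i hi
      simp only [pr, map_sub, map_sum, map_smul, smul_eq_mul]
      rw [Finset.sum_congr rfl (fun j hj => by rw [hz i hi j hj])]
      simp [hi]
    exact hz' _ _ (this a) (this b)
  have h2 : DifferentiableAt ℝ (fderiv ℝ η) y :=
    (hη.fderiv_right (m := 1) (by norm_cast)).differentiableAt (by norm_num)
  -- Differentiate dη(pr a, pr b) = 0 in the direction c. Since τ i (a) = 0 at y, the derivative of
  -- pr a is -∑ (D_c τ i)(a) e i, so the derivative of dη(a, b) is expressed by first derivatives of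
  -- the τ i. The cyclic sum of these expressions then vanishes because d(dη) = 0.
  have hmain : ∀ a b c : E, (∀ i ∈ s, τ i y a = 0) → (∀ i ∈ s, τ i y b = 0) →
      fderiv ℝ (fun z => dFlat η z a b) y c = ∑ i ∈ s,
        (fderiv ℝ (τ i) y c a * dFlat η y (e i y) b - fderiv ℝ (τ i) y c b *
          dFlat η y (e i y) a) := by
    intro a b c ha hb
    have hgen : ∀ a b, (∀ i ∈ s, τ i y a = 0) → (∀ i ∈ s, τ i y b = 0) →
        HasFDerivAt (fun z => fderiv ℝ η z (pr a z) (pr b z))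
        (((fderiv ℝ (fderiv ℝ η) y).flip a).flip b +
          ((fderiv ℝ η y).flip b).comp (-∑ i ∈ s, ((fderiv ℝ (τ i) y).flip a).smulRight (e i y)) +
          (fderiv ℝ η y a).comp (-∑ i ∈ s, ((fderiv ℝ (τ i) y).flip b).smulRight (e i y))) y := by
      intro a b ha hb
      have h3 := (h2.hasFDerivAt.clm_apply (hpr a ha)).clm_apply (hpr b hb)
      exact h3.congr_fderiv (by ext t; simp [hpry a ha, hpry b hb]; ring)
    have hsub := (hgen a b ha hb).sub (hgen b a hb ha)
    have hz : HasFDerivAt (fun z => dFlat η z (pr a z) (pr b z)) (0 : E →L[ℝ] ℝ) y :=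
      (hasFDerivAt_const (0 : ℝ) y).congr_of_eventuallyEq (hker a b)
    have heq := DFunLike.congr_fun (hsub.unique hz) c
    have h : ∀ a b : E, HasFDerivAt (fun z => fderiv ℝ η z a b)
        (((fderiv ℝ (fderiv ℝ η) y).flip a).flip b) y := by
      intro a b
      have h1 := h2.hasFDerivAt.clm_apply (hasFDerivAt_const a y)
      exact (h1.clm_apply (hasFDerivAt_const b y)).congr_fderiv (by ext; simp)
    have hc := ((h a b).sub (h b a)).fderiv
    have hc' : fderiv ℝ (fun z => dFlat η z a b) y c =
        fderiv ℝ (fderiv ℝ η) y c a b - fderiv ℝ (fderiv ℝ η) y c b a := by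
      simp only [dFlat_apply]
      erw [hc]
      simp
    rw [hc']
    simp only [_root_.sub_apply, _root_.add_apply,
      ContinuousLinearMap.flip_apply, ContinuousLinearMap.comp_apply,
      _root_.neg_apply, _root_.sum_apply, map_neg, map_sum,
      ContinuousLinearMap.smulRight_apply, map_smul, smul_eq_mul,
      _root_.zero_apply] at heq
    simp only [dFlat_apply, mul_sub, Finset.sum_sub_distrib]
    linarith
  have hcyc := dFlat_cyclic (hη.of_le (by norm_cast)) u v w
  rw [hmain v w u hv hw, hmain w u v hw hu, hmain u v w hu hv] at hcyc
  rw [← Finset.sum_add_distrib, ← Finset.sum_add_distrib] at hcyc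
  rw [← hcyc]
  refine Finset.sum_congr rfl fun i _ => ?_
  simp only [dFlat_apply (τ i)]
  ring

/-- A smooth coframe on a finite-dimensional space has a smooth dual frame. -/
lemma exists_smooth_dual_frame [FiniteDimensional ℝ E] {ι : Type*} [Fintype ι] [DecidableEq ι]
    {τ : ι → E → E →L[ℝ] ℝ} {y : E} (hτ : ∀ i, ContDiffAt ℝ ∞ (τ i) y) {e₀ : ι → E}
    (h₀ : ∀ i j, τ i y (e₀ j) = if i = j then 1 else 0)
    (hcard : Fintype.card ι = Module.finrank ℝ E) :
    ∃ e : ι → E → E, (∀ j, ContDiffAt ℝ ∞ (e j) y) ∧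
      ∀ᶠ z in nhds y, ∀ i j, τ i z (e j z) = if i = j then 1 else 0 := by
  have : CompleteSpace E := FiniteDimensional.complete ℝ E
  let Θ : E → E →L[ℝ] (ι → ℝ) := fun z => ContinuousLinearMap.pi fun i => τ i z
  have hΘ : ContDiffAt ℝ ∞ Θ y := by
    let L : (ι → E →L[ℝ] ℝ) →L[ℝ] (E →L[ℝ] (ι → ℝ)) :=
      LinearMap.toContinuousLinearMap
      { toFun := fun t => ContinuousLinearMap.pi t
        map_add' := fun _ _ => rfl
        map_smul' := fun _ _ => rfl }
    exact L.contDiff.contDiffAt.comp y (contDiffAt_pi.2 hτ)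
  have hsurj : Function.Surjective (Θ y) := by
    intro c
    refine ⟨∑ j, c j • e₀ j, ?_⟩
    ext i
    simp [Θ, h₀]
  have hbij : Function.Bijective (Θ y) := by
    refine ⟨?_, hsurj⟩
    exact (LinearMap.injective_iff_surjective_of_finrank_eq_finrank
      (f := (Θ y).toLinearMap) (by simp [hcard])).2 hsurj
  let A : E ≃L[ℝ] (ι → ℝ) :=
    (LinearEquiv.ofBijective (Θ y).toLinearMap hbij).toContinuousLinearEquiv
  have hA : (A : E →L[ℝ] (ι → ℝ)) = Θ y := by ext; rfl
  -- The dual frame consists of the columns of the inverse of the coframe matrix; inversion is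
  -- smooth at an invertible map, and nearby maps are still invertible.
  have hinv : ContDiffAt ℝ ∞ (fun z => (Θ z).inverse) y := by
    have := contDiffAt_map_inverse (n := ∞) A
    rw [hA] at this
    exact this.comp y hΘ
  refine ⟨fun j z => (Θ z).inverse (Pi.single j 1), fun j => hinv.clm_apply contDiffAt_const, ?_⟩
  have hopen : ∀ᶠ z in nhds y, Θ z ∈ Set.range ((↑) : (E ≃L[ℝ] (ι → ℝ)) → E →L[ℝ] (ι → ℝ)) := by
    refine hΘ.continuousAt.eventually ?_
    rw [← hA]
    exact ContinuousLinearEquiv.nhds A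
  filter_upwards [hopen] with z hz i j
  obtain ⟨B, hB⟩ := hz
  rw [← hB, ContinuousLinearMap.inverse_equiv]
  have : τ i z (B.symm (Pi.single j 1)) = Θ z (B.symm (Pi.single j 1)) i := rfl
  simp only [ContinuousLinearEquiv.coe_coe]
  rw [this, ← hB]
  simp [Pi.single_apply]

end Flat

/-! ### Exterior derivatives of one-forms on manifolds -/

section Naturality

variable {m n : ℕ} {N : Type*} [TopologicalSpace N] [ChartedSpace (EuclideanSpace ℝ (Fin m)) N]
  {M : Type*} [TopologicalSpace M] [ChartedSpace (EuclideanSpace ℝ (Fin n)) M]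

/-- The values of a one-form, as linear forms on the model space. -/
def OneForm.val (α : OneForm n M) (a : M) : EuclideanSpace ℝ (Fin n) →L[ℝ] ℝ := α a

/-- The values of a one-form at equal points agree. -/
lemma OneForm.congr_point (α : OneForm n M) {a b : M} (h : a = b) :
    OneForm.val α a = OneForm.val α b := by
  subst h; rfl

/-- A one-form is smooth at a point if its expression in the preferred chart at this point is. -/
def OneForm.SmoothAt (η : OneForm n M) (q : M) : Prop :=
  ContDiffAt ℝ ∞ (OneForm.inChart η q) (extChartAt (𝓡 n) q q)

/-- The pullback of a one-form. -/
def OneForm.pullback (f : N → M) (α : OneForm n M) : OneForm m N := fun z => pullOne f z (α (f z))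

lemma OneForm.d_apply (η : OneForm n M) (q : M) (u v : TangentSpace (𝓡 n) q) :
    OneForm.d η q u v = dFlat (OneForm.inChart η q) (extChartAt (𝓡 n) q q) u v := rfl

section Model

variable (β : OneForm n (EuclideanSpace ℝ (Fin n)))

lemma OneForm.inChart_model (y : EuclideanSpace ℝ (Fin n)) :
    OneForm.inChart β y = OneForm.val β := by
  funext z
  have h : (extChartAt (𝓡 n) y).symm = PartialEquiv.refl (EuclideanSpace ℝ (Fin n)) := by
    rw [extChartAt_model_space_eq_id]; rfl
  unfold OneForm.inChart
  rw [h]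
  change (β z).comp (mfderiv (𝓡 n) (𝓡 n) id z) = β z
  rw [mfderiv_id]
  rfl

/-- For use with the pullback of a form under the inverse of a chart: on the model space every
preferred chart is the identity, so the pointwise choice of charts in `OneForm.d` disappears. -/
lemma OneForm.d_model (y : EuclideanSpace ℝ (Fin n)) (u v : EuclideanSpace ℝ (Fin n)) :
    OneForm.d β y u v = dFlat (OneForm.val β) y u v := by
  change dFlat (OneForm.inChart β y) (extChartAt (𝓡 n) y y) u v = _
  rw [OneForm.inChart_model, extChartAt_model_space_eq_id]
  rfl

end Model

lemma contDiffAt_written {f : N → M} {q : N} (hf : ContMDiffAt (𝓡 m) (𝓡 n) ∞ f q) :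
    ContDiffAt ℝ ∞ (writtenInExtChartAt (𝓡 m) (𝓡 n) q f) (extChartAt (𝓡 m) q q) := by
  have := (contMDiffAt_iff.1 hf).2
  rw [ModelWithCorners.Boundaryless.range_eq_univ] at this
  exact contDiffWithinAt_univ.1 this

variable [IsManifold (𝓡 m) ∞ N] [IsManifold (𝓡 n) ∞ M]

lemma contMDiffAt_extChartAt_symm {p : M} {y : EuclideanSpace ℝ (Fin n)}
    (hy : y ∈ (extChartAt (𝓡 n) p).target) :
    ContMDiffAt (𝓡 n) (𝓡 n) ∞ (extChartAt (𝓡 n) p).symm y :=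
  (contMDiffOn_extChartAt_symm p).contMDiffAt ((isOpen_extChartAt_target p).mem_nhds hy)

/-- With φ, ψ the charts and F the coordinate expression of f, the maps f ∘ φ⁻¹ and ψ⁻¹ ∘ F agree
near φ(q); the two sides are the pullbacks of `α` under them, computed by the chain rule. Equality
on a neighbourhood is needed because it will be differentiated. -/
lemma OneForm.inChart_pullback {f : N → M} {q : N} (hf : ContMDiffAt (𝓡 m) (𝓡 n) ∞ f q)
    (α : OneForm n M) :
    OneForm.inChart (OneForm.pullback f α) q =ᶠ[nhds (extChartAt (𝓡 m) q q)] fun z =>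
      (OneForm.inChart α (f q) (writtenInExtChartAt (𝓡 m) (𝓡 n) q f z)).comp
        (fderiv ℝ (writtenInExtChartAt (𝓡 m) (𝓡 n) q f) z) := by
  set φ := extChartAt (𝓡 m) q
  set ψ := extChartAt (𝓡 n) (f q)
  set F := writtenInExtChartAt (𝓡 m) (𝓡 n) q f
  have hφc : ContinuousAt φ.symm (φ q) := continuousAt_extChartAt_symm q
  have hφq : φ.symm (φ q) = q := extChartAt_to_inv q
  have hfs : ∀ᶠ z in nhds q, ContMDiffAt (𝓡 m) (𝓡 n) 1 f z :=
    (contMDiffAt_iff_contMDiffAt_nhds (by simp)).1 (hf.of_le (by norm_cast))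
  have h1 : ∀ᶠ z in nhds (φ q), z ∈ φ.target := extChartAt_target_mem_nhds q
  have h2 : ∀ᶠ z in nhds (φ q), ContMDiffAt (𝓡 m) (𝓡 n) 1 f (φ.symm z) := by
    have : Filter.Tendsto φ.symm (nhds (φ q)) (nhds q) := by
      simpa [ContinuousAt, hφq] using hφc
    exact this.eventually hfs
  have h3 : ∀ᶠ z in nhds (φ q), f (φ.symm z) ∈ ψ.source := by
    have : Filter.Tendsto (f ∘ φ.symm) (nhds (φ q)) (nhds (f q)) := by
      refine Filter.Tendsto.comp (y := nhds q) hf.continuousAt ?_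
      simpa [ContinuousAt, hφq] using hφc
    exact this.eventually (extChartAt_source_mem_nhds (f q))
  have hF : ∀ᶠ z in nhds (φ q), ContDiffAt ℝ 1 F z :=
    ((contDiffAt_written hf).of_le (by norm_cast)).eventually (by simp)
  filter_upwards [h1, h2, h3.eventually_nhds, hF] with z hz1 hz2 hz3 hz4
  have e1 : ∀ᶠ x in nhds z, f (φ.symm x) = ψ.symm (F x) := by
    filter_upwards [hz3] with x hx
    exact (ψ.left_inv hx).symm
  have e2 : F z ∈ ψ.target := ψ.map_source hz3.self_of_nhds
  have d1 : MDifferentiableAt (𝓡 m) (𝓡 n) f (φ.symm z) := hz2.mdifferentiableAt (by norm_num)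
  have d2 : MDifferentiableAt (𝓡 m) (𝓡 m) φ.symm z :=
    (contMDiffAt_extChartAt_symm hz1).mdifferentiableAt (by norm_num)
  have d3 : MDifferentiableAt (𝓡 n) (𝓡 n) ψ.symm (F z) :=
    (contMDiffAt_extChartAt_symm e2).mdifferentiableAt (by norm_num)
  have d4 : MDifferentiableAt (𝓡 m) (𝓡 n) F z :=
    (hz4.differentiableAt (by norm_num)).mdifferentiableAt
  have c1 := mfderiv_comp z d1 d2
  have c2 := mfderiv_comp z d3 d4
  have c3 : mfderiv (𝓡 m) (𝓡 n) (f ∘ φ.symm) z = mfderiv (𝓡 m) (𝓡 n) (ψ.symm ∘ F) z :=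
    Filter.EventuallyEq.mfderiv_eq e1
  have c4 : mfderiv (𝓡 m) (𝓡 n) F z = fderiv ℝ F z := mfderiv_eq_fderiv
  ext v
  have k1 := DFunLike.congr_fun c1 v
  have k2 := DFunLike.congr_fun c2 v
  have k3 := DFunLike.congr_fun c3 v
  have k4 := DFunLike.congr_fun c4 v
  have k5 := OneForm.congr_point α e1.self_of_nhds
  change α (f (φ.symm z)) (mfderiv (𝓡 m) (𝓡 n) f (φ.symm z) (mfderiv (𝓡 m) (𝓡 m) φ.symm z v)) =
    α (ψ.symm (F z)) (mfderiv (𝓡 n) (𝓡 n) ψ.symm (F z) (fderiv ℝ F z v))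
  have k6 : (mfderiv (𝓡 m) (𝓡 n) f (φ.symm z) (mfderiv (𝓡 m) (𝓡 m) φ.symm z v) :
      EuclideanSpace ℝ (Fin n)) = mfderiv (𝓡 n) (𝓡 n) ψ.symm (F z) (fderiv ℝ F z v) := by
    exact k1.symm.trans (k3.trans (k2.trans
      (congrArg (mfderiv (𝓡 n) (𝓡 n) ψ.symm (F z)) k4)))
  exact (congrArg (α (f (φ.symm z))) k6).trans (DFunLike.congr_fun k5 _)

lemma OneForm.smoothAt_pullback {f : N → M} {q : N} (hf : ContMDiffAt (𝓡 m) (𝓡 n) ∞ f q)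
    {α : OneForm n M} (hα : OneForm.SmoothAt α (f q)) :
    OneForm.SmoothAt (OneForm.pullback (m := m) f α) q := by
  have hF := contDiffAt_written (m := m) (n := n) hf
  have h0 : writtenInExtChartAt (𝓡 m) (𝓡 n) q f (extChartAt (𝓡 m) q q) =
      extChartAt (𝓡 n) (f q) (f q) := by simp [writtenInExtChartAt]
  refine ContDiffAt.congr_of_eventuallyEq ?_ (OneForm.inChart_pullback (m := m) (n := n) hf α)
  refine ContDiffAt.clm_comp ?_ (hF.fderiv_right (by norm_cast))
  refine ContDiffAt.comp (g := OneForm.inChart α (f q)) _ ?_ hF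
  rw [h0]; exact hα

/-- The exterior derivative commutes with pullback. -/
lemma OneForm.d_pullback {f : N → M} {q : N} (hf : ContMDiffAt (𝓡 m) (𝓡 n) ∞ f q)
    {α : OneForm n M} (hα : OneForm.SmoothAt α (f q)) (u v : TangentSpace (𝓡 m) q) :
    OneForm.d (OneForm.pullback f α) q u v =
      OneForm.d α (f q) (mfderiv (𝓡 m) (𝓡 n) f q u) (mfderiv (𝓡 m) (𝓡 n) f q v) := by
  have hF := contDiffAt_written (m := m) (n := n) hf
  have h0 : writtenInExtChartAt (𝓡 m) (𝓡 n) q f (extChartAt (𝓡 m) q q) =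
      extChartAt (𝓡 n) (f q) (f q) := by simp [writtenInExtChartAt]
  have hd : mfderiv (𝓡 m) (𝓡 n) f q =
      fderiv ℝ (writtenInExtChartAt (𝓡 m) (𝓡 n) q f) (extChartAt (𝓡 m) q q) := by
    rw [(hf.mdifferentiableAt (by norm_num)).mfderiv,
      ModelWithCorners.Boundaryless.range_eq_univ]
    exact congrFun fderivWithin_univ _
  rw [OneForm.d_apply (n := m), OneForm.d_apply (n := n),
    dFlat_congr (OneForm.inChart_pullback (m := m) (n := n) hf α)]
  have := dFlat_pullback (α := OneForm.inChart α (f q)) (hF.of_le (by norm_cast))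
    (by rw [h0]; exact hα.differentiableAt (by norm_num)) u v
  rw [hd, ← h0]
  exact this

/-- The exterior derivative may be computed in any of the preferred charts. -/
lemma OneForm.d_inChart {η : OneForm n M} {p : M} {y : EuclideanSpace ℝ (Fin n)}
    (hy : y ∈ (extChartAt (𝓡 n) p).target)
    (hη : OneForm.SmoothAt η ((extChartAt (𝓡 n) p).symm y)) (u v : EuclideanSpace ℝ (Fin n)) :
    OneForm.d η ((extChartAt (𝓡 n) p).symm y)
      (mfderiv (𝓡 n) (𝓡 n) (extChartAt (𝓡 n) p).symm y u)
      (mfderiv (𝓡 n) (𝓡 n) (extChartAt (𝓡 n) p).symm y v) =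
      dFlat (OneForm.inChart η p) y u v :=
  (OneForm.d_pullback (contMDiffAt_extChartAt_symm hy) hη u v).symm.trans
    (OneForm.d_model (OneForm.pullback (extChartAt (𝓡 n) p).symm η) y u v)

lemma mfderiv_extChartAt_symm_self (p : M) :
    mfderiv (𝓡 n) (𝓡 n) (extChartAt (𝓡 n) p).symm (extChartAt (𝓡 n) p p) =
      ContinuousLinearMap.id ℝ (EuclideanSpace ℝ (Fin n)) := by
  have := mfderivWithin_range_extChartAt_symm (I := 𝓡 n) (x := p)
  rw [ModelWithCorners.Boundaryless.range_eq_univ, mfderivWithin_univ] at this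
  exact this

lemma OneForm.inChart_self (η : OneForm n M) (p : M) :
    OneForm.inChart η p (extChartAt (𝓡 n) p p) = η p := by
  ext v
  have h := OneForm.congr_point η (extChartAt_to_inv (I := 𝓡 n) p)
  have h2 := DFunLike.congr_fun (mfderiv_extChartAt_symm_self (n := n) p) v
  unfold OneForm.inChart
  exact (congrArg (η ((extChartAt (𝓡 n) p).symm (extChartAt (𝓡 n) p p))) h2).trans
    (DFunLike.congr_fun h _)

end Naturality

/-! ### Moving frames -/

section MovingFrame

variable {n : ℕ} {M : Type*} [TopologicalSpace M] [ChartedSpace (EuclideanSpace ℝ (Fin n)) M]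

/-- `τ` is a smooth coframe on the open set `U`, and `e` is the dual frame. -/
structure IsMovingFrame (U : Set M) (τ : Fin n → OneForm n M)
    (e : Fin n → ∀ q : M, TangentSpace (𝓡 n) q) : Prop where
  isOpen : IsOpen U
  smooth : ∀ i, OneForm.SmoothOn (τ i) U
  dual : ∀ q ∈ U, ∀ i j, τ i q (e j q) = if i = j then 1 else 0

namespace IsMovingFrame

variable {U : Set M} {τ : Fin n → OneForm n M} {e : Fin n → ∀ q : M, TangentSpace (𝓡 n) q}
  (h : IsMovingFrame U τ e)

include h

lemma smoothAt (i : Fin n) {q : M} (hq : q ∈ U) : OneForm.SmoothAt (τ i) q := h.smooth i q hq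

lemma linearIndependent {q : M} (hq : q ∈ U) : LinearIndependent ℝ fun j => e j q := by
  rw [Fintype.linearIndependent_iff]
  intro g hg i
  have := congrArg (τ i q) hg
  simpa [h.dual q hq] using this

lemma sum_smul {q : M} (hq : q ∈ U) (v : TangentSpace (𝓡 n) q) :
    ∑ j, τ j q v • e j q = v := by
  have hfin : Module.finrank ℝ (TangentSpace (𝓡 n) q) = n := by
    change Module.finrank ℝ (EuclideanSpace ℝ (Fin n)) = n
    simp
  have hspan : ⊤ ≤ Submodule.span ℝ (Set.range fun j => e j q) := by
    have : FiniteDimensional ℝ (TangentSpace (𝓡 n) q) := by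
      change FiniteDimensional ℝ (EuclideanSpace ℝ (Fin n))
      infer_instance
    exact ((h.linearIndependent hq).span_eq_top_of_card_eq_finrank' (by simp [hfin])).ge
  obtain ⟨c, hc⟩ := (Submodule.mem_span_range_iff_exists_fun ℝ).1
    (hspan (Submodule.mem_top (x := v)))
  have hτ : ∀ j, τ j q v = c j := by
    intro j
    have := congrArg (τ j q) hc
    rw [← this]
    simp [h.dual q hq]
  simp only [hτ, hc]

lemma ext_vector {q : M} (hq : q ∈ U) {v w : TangentSpace (𝓡 n) q}
    (hvw : ∀ i, τ i q v = τ i q w) : v = w := by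
  rw [← h.sum_smul hq v, ← h.sum_smul hq w]
  simp [hvw]

variable [IsManifold (𝓡 n) ∞ M]

/-- The expression of a moving frame in the preferred chart at a point. -/
lemma exists_chart_frame {p : M} (hp : p ∈ U) :
    ∃ f : Fin n → EuclideanSpace ℝ (Fin n) → EuclideanSpace ℝ (Fin n),
      (∀ j, ContDiffAt ℝ ∞ (f j) (extChartAt (𝓡 n) p p)) ∧
      ∀ᶠ y in nhds (extChartAt (𝓡 n) p p), y ∈ (extChartAt (𝓡 n) p).target ∧
        (extChartAt (𝓡 n) p).symm y ∈ U ∧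
        (∀ i j, OneForm.inChart (τ i) p y (f j y) = if i = j then 1 else 0) ∧
        (∀ j, mfderiv (𝓡 n) (𝓡 n) (extChartAt (𝓡 n) p).symm y (f j y) =
          e j ((extChartAt (𝓡 n) p).symm y)) := by
  have hinv : (extChartAt (𝓡 n) p).symm (extChartAt (𝓡 n) p p) = p := extChartAt_to_inv p
  obtain ⟨f, hf, hd⟩ := exists_smooth_dual_frame
    (τ := fun i => OneForm.inChart (τ i) p) (y := extChartAt (𝓡 n) p p)
    (fun i => h.smoothAt i hp) (e₀ := fun j => e j p)
    (by
      intro i j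
      rw [OneForm.inChart_self]
      exact h.dual p hp i j) (by simp)
  refine ⟨f, hf, ?_⟩
  have hU : ∀ᶠ y in nhds (extChartAt (𝓡 n) p p), (extChartAt (𝓡 n) p).symm y ∈ U := by
    have hc : ContinuousAt (extChartAt (𝓡 n) p).symm (extChartAt (𝓡 n) p p) :=
      continuousAt_extChartAt_symm p
    exact hc.eventually (by rw [hinv]; exact h.isOpen.mem_nhds hp)
  filter_upwards [hd, hU, extChartAt_target_mem_nhds (I := 𝓡 n) p] with y hy1 hy2 hy3
  -- No smoothness of `e` is assumed. A vector is determined by its values under the coframe, so `e`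
  -- has to be the smooth dual frame found in the chart.
  refine ⟨hy3, hy2, hy1, fun j => h.ext_vector hy2 fun i => ?_⟩
  rw [h.dual _ hy2]
  exact hy1 i j

/-- The components of the exterior derivative of a smooth form are smooth. -/
lemma contDiffAt_d_apply {η : OneForm n M} {p : M} (hp : p ∈ U) (hη : OneForm.SmoothOn η U)
    (a b : Fin n) :
    ContDiffAt ℝ ∞ (fun y => OneForm.d η ((extChartAt (𝓡 n) p).symm y)
      (e a ((extChartAt (𝓡 n) p).symm y)) (e b ((extChartAt (𝓡 n) p).symm y)))
      (extChartAt (𝓡 n) p p) := by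
  obtain ⟨f, hf, hev⟩ := h.exists_chart_frame hp
  refine (contDiffAt_dFlat_apply (n := ⊤) (hη p hp) (hf a) (hf b)).congr_of_eventuallyEq ?_
  filter_upwards [hev] with y hy
  obtain ⟨h1, h2, -, h4⟩ := hy
  rw [← h4, ← h4]
  exact OneForm.d_inChart h1 (hη _ h2) _ _

/-- The exterior derivative of a section of the span of some of the forms of a coframe, on the
common kernel of these forms. -/
lemma d_apply_of_mem_span (s : Finset (Fin n)) {β : OneForm n M} {p : M} (hp : p ∈ U)
    (hβ : OneForm.SmoothAt β p)
    (hspan : ∀ᶠ q in nhds p, ∀ i ∉ s, β q (e i q) = 0)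
    {u v : TangentSpace (𝓡 n) p} (hu : ∀ i ∈ s, τ i p u = 0) (hv : ∀ i ∈ s, τ i p v = 0) :
    OneForm.d β p u v = ∑ i ∈ s, β p (e i p) * OneForm.d (τ i) p u v := by
  have hinv : (extChartAt (𝓡 n) p).symm (extChartAt (𝓡 n) p p) = p := extChartAt_to_inv p
  obtain ⟨f, hf, hev⟩ := h.exists_chart_frame hp
  set y₀ := extChartAt (𝓡 n) p p
  have hc : ∀ᶠ y in nhds y₀, ∀ i ∉ s, OneForm.inChart β p y (f i y) = 0 := by
    have hc : ContinuousAt (extChartAt (𝓡 n) p).symm y₀ := continuousAt_extChartAt_symm p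
    have := hc.eventually (p := fun q => ∀ i ∉ s, β q (e i q) = 0) (by rw [hinv]; exact hspan)
    filter_upwards [this, hev] with y hy1 hy2 i hi
    have := hy1 i hi
    rw [← hy2.2.2.2] at this
    exact this
  have heq : OneForm.inChart β p =ᶠ[nhds y₀] fun z =>
      ∑ i ∈ s, OneForm.inChart β p z (f i z) • OneForm.inChart (τ i) p z := by
    filter_upwards [hc, hev] with y hy1 hy2
    ext w
    have hw : w = ∑ j, OneForm.inChart (τ j) p y w • f j y := by
      have hli : LinearIndependent ℝ fun j => f j y := by
        rw [Fintype.linearIndependent_iff]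
        intro g hg i
        have := congrArg (OneForm.inChart (τ i) p y) hg
        simpa [hy2.2.2.1] using this
      have hspan := hli.span_eq_top_of_card_eq_finrank' (by simp)
      obtain ⟨c, hc⟩ := (Submodule.mem_span_range_iff_exists_fun ℝ).1
        (hspan.ge (Submodule.mem_top (x := w)))
      have hτ : ∀ j, OneForm.inChart (τ j) p y w = c j := by
        intro j
        rw [← hc]
        simp [hy2.2.2.1]
      simp only [hτ, hc]
    conv_lhs => rw [hw]
    simp only [map_sum, map_smul, smul_eq_mul, _root_.sum_apply, _root_.smul_apply]
    rw [← Finset.sum_subset (Finset.subset_univ s)]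
    · exact Finset.sum_congr rfl fun i _ => mul_comm _ _
    · intro i _ hi
      rw [hy1 i hi, mul_zero]
  rw [OneForm.d_apply, dFlat_congr heq]
  have hval : ∀ i, OneForm.inChart β p y₀ (f i y₀) = β p (e i p) := by
    intro i
    have h4 := hev.self_of_nhds.2.2.2 i
    have h5 := hev.self_of_nhds.2.2.1
    rw [OneForm.inChart_self]
    refine congrArg (β p) (h.ext_vector hp fun k => ?_)
    have := h5 k i
    rw [OneForm.inChart_self] at this
    rw [h.dual p hp]
    exact this
  refine (dFlat_sum_smul s (u := u) (v := v)
    (fun i _ => ((hβ.clm_apply (hf i)).differentiableAt (by norm_num)))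
    (fun i _ => (h.smoothAt i hp).differentiableAt (by norm_num))
    (fun i hi => by rw [OneForm.inChart_self]; exact hu i hi)
    (fun i hi => by rw [OneForm.inChart_self]; exact hv i hi)).trans ?_
  refine Finset.sum_congr rfl fun i _ => ?_
  rw [hval]
  rfl

end IsMovingFrame

end MovingFrame

section MovingFrame

variable {n : ℕ} {M : Type*} [TopologicalSpace M] [ChartedSpace (EuclideanSpace ℝ (Fin n)) M]

lemma OneForm.d_swap (η : OneForm n M) (q : M) (u v : TangentSpace (𝓡 n) q) :
    OneForm.d η q u v = -OneForm.d η q v u :=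
  dFlat_swap (E := EuclideanSpace ℝ (Fin n)) (OneForm.inChart η q) _ u v

lemma OneForm.d_self (η : OneForm n M) (q : M) (u : TangentSpace (𝓡 n) q) :
    OneForm.d η q u u = 0 :=
  dFlat_self (E := EuclideanSpace ℝ (Fin n)) (OneForm.inChart η q) _ u

lemma OneForm.smoothAt_smul {g : M → ℝ} {η : OneForm n M} {p : M}
    (hg : ContDiffAt ℝ ∞ (fun y => g ((extChartAt (𝓡 n) p).symm y)) (extChartAt (𝓡 n) p p))
    (hη : OneForm.SmoothAt η p) : OneForm.SmoothAt (fun q => g q • η q) p :=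
  ContDiffAt.smul hg hη

lemma OneForm.smoothAt_add {η η' : OneForm n M} {p : M} (hη : OneForm.SmoothAt η p)
    (hη' : OneForm.SmoothAt η' p) : OneForm.SmoothAt (fun q => η q + η' q) p := by
  have h := ContDiffAt.add hη hη'
  refine h.congr_of_eventuallyEq (Filter.Eventually.of_forall fun y => ?_)
  exact ContinuousLinearMap.add_comp _ _ _

lemma OneForm.smoothAt_sum {ι : Type*} (s : Finset ι) (c : ι → ℝ) {η : ι → OneForm n M} {p : M}
    (hη : ∀ i ∈ s, OneForm.SmoothAt (η i) p) :
    OneForm.SmoothAt (fun q => ∑ i ∈ s, c i • η i q) p := by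
  classical
  induction s using Finset.induction_on with
  | empty =>
    refine (contDiffAt_const (c := (0 : EuclideanSpace ℝ (Fin n) →L[ℝ] ℝ))).congr_of_eventuallyEq
      (Filter.Eventually.of_forall fun y => ?_)
    exact ContinuousLinearMap.zero_comp _
  | insert i s hi ih =>
    simp only [Finset.sum_insert hi]
    exact OneForm.smoothAt_add
      (OneForm.smoothAt_smul contDiffAt_const (hη i (Finset.mem_insert_self i s)))
      (ih fun j hj => hη j (Finset.mem_insert_of_mem hj))

variable {U : Set M} {τ : Fin n → OneForm n M} {e : Fin n → ∀ q : M, TangentSpace (𝓡 n) q}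

/-- A bilinear form that vanishes on some of the vectors of a frame vanishes on their span. -/
lemma IsMovingFrame.bilin_eq_zero (h : IsMovingFrame U τ e) {q : M} (hq : q ∈ U) {Φ : Bilin n q}
    (s : Finset (Fin n)) (hΦ : ∀ i ∉ s, ∀ j ∉ s, Φ (e i q) (e j q) = 0)
    {u v : TangentSpace (𝓡 n) q} (hu : ∀ i ∈ s, τ i q u = 0) (hv : ∀ i ∈ s, τ i q v = 0) :
    Φ u v = 0 := by
  rw [← h.sum_smul hq u, ← h.sum_smul hq v]
  simp only [map_sum, LinearMap.sum_apply, map_smul, LinearMap.smul_apply]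
  refine Finset.sum_eq_zero fun j _ => smul_eq_zero.2 (or_iff_not_imp_left.2 fun hvj =>
    Finset.sum_eq_zero fun i _ => ?_)
  by_cases hi : i ∈ s
  · simp [hu i hi]
  have hj : j ∉ s := fun hj => hvj (hv j hj)
  simp [hΦ i hi j hj]

variable [IsManifold (𝓡 n) ∞ M]

/-- If `dη` vanishes on the common kernel of the forms `τ i`, `i ∈ s`, so that
`dη = ∑ τ i ∧ α i`, then `∑ dτ i ∧ α i` vanishes on this kernel. -/
lemma IsMovingFrame.d_cyclic (h : IsMovingFrame U τ e) (s : Finset (Fin n)) {η : OneForm n M}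
    {p : M} (hp : p ∈ U) (hη : ∀ᶠ q in nhds p, OneForm.SmoothAt η q)
    (hvan : ∀ᶠ q in nhds p, ∀ i ∉ s, ∀ j ∉ s, OneForm.d η q (e i q) (e j q) = 0)
    {u v w : TangentSpace (𝓡 n) p} (hu : ∀ i ∈ s, τ i p u = 0) (hv : ∀ i ∈ s, τ i p v = 0)
    (hw : ∀ i ∈ s, τ i p w = 0) :
    ∑ i ∈ s, (OneForm.d (τ i) p u v * OneForm.d η p (e i p) w +
      OneForm.d (τ i) p v w * OneForm.d η p (e i p) u +
      OneForm.d (τ i) p w u * OneForm.d η p (e i p) v) = 0 := by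
  have hinv : (extChartAt (𝓡 n) p).symm (extChartAt (𝓡 n) p p) = p := extChartAt_to_inv p
  obtain ⟨f, hf, hev⟩ := h.exists_chart_frame hp
  have hc : ContinuousAt (extChartAt (𝓡 n) p).symm (extChartAt (𝓡 n) p p) :=
    continuousAt_extChartAt_symm p
  have hη' := hc.eventually (p := fun q => OneForm.SmoothAt η q) (by rw [hinv]; exact hη)
  have hvan' := hc.eventually (p := fun q => ∀ i ∉ s, ∀ j ∉ s,
    OneForm.d η q (e i q) (e j q) = 0) (by rw [hinv]; exact hvan)
  have hf0 : ∀ i, f i (extChartAt (𝓡 n) p p) = e i p := by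
    intro i
    refine h.ext_vector hp fun k => ?_
    have := hev.self_of_nhds.2.2.1 k i
    rw [OneForm.inChart_self] at this
    rw [h.dual p hp]
    exact this
  have key := dFlat_cyclic_of_vanishing s (τ := fun i => OneForm.inChart (τ i) p) (e := f)
    (η := OneForm.inChart η p) (y := extChartAt (𝓡 n) p p) hη.self_of_nhds
    (fun i _ => (h.smoothAt i hp).differentiableAt (by norm_num))
    (fun i _ => (hf i).differentiableAt (by norm_num))
    (hev.mono fun y hy i _ j _ => hy.2.2.1 i j)
    (by
      filter_upwards [hev, hη', hvan'] with y hy hy2 hy3 a b ha hb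
      rw [← OneForm.d_inChart hy.1 hy2]
      exact h.bilin_eq_zero hy.2.1 s hy3 ha hb) (u := u) (v := v) (w := w)
    (fun i hi => by rw [OneForm.inChart_self]; exact hu i hi)
    (fun i hi => by rw [OneForm.inChart_self]; exact hv i hi)
    (fun i hi => by rw [OneForm.inChart_self]; exact hw i hi)
  simp only [hf0] at key
  exact key

end MovingFrame

/-! ### Ideals of forms -/

section Ideal

variable {V : Type*} [AddCommGroup V] [Module ℝ V] [TopologicalSpace V]

lemma wedge_apply (a b : V →L[ℝ] ℝ) (u v : V) : wedge a b u v = a u * b v - a v * b u := rfl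

lemma apply_eq_zero_of_mem_wedgeIdeal {L : Submodule ℝ (V →L[ℝ] ℝ)} {Φ : LinearMap.BilinForm ℝ V}
    (hΦ : Φ ∈ wedgeIdeal L) {u v : V} (hu : ∀ α ∈ L, α u = 0) (hv : ∀ α ∈ L, α v = 0) :
    Φ u v = 0 := by
  induction hΦ using Submodule.span_induction with
  | mem x hx =>
    obtain ⟨α, hα, β, rfl⟩ := hx
    simp [wedge_apply, hu α hα, hv α hα]
  | zero => rfl
  | add x y _ _ hx hy => simp [hx, hy]
  | smul c x _ hx => simp [hx]

lemma CongrMod.apply_eq {θ : V →L[ℝ] ℝ} {Φ Φ' : LinearMap.BilinForm ℝ V} (h : CongrMod θ Φ Φ')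
    {u v : V} (hu : θ u = 0) (hv : θ v = 0) : Φ u v = Φ' u v := by
  have hL : ∀ {w : V}, θ w = 0 → ∀ α ∈ Submodule.span ℝ {θ}, α w = 0 := by
    intro w hw α hα
    obtain ⟨c, rfl⟩ := Submodule.mem_span_singleton.1 hα
    simp [hw]
  have := apply_eq_zero_of_mem_wedgeIdeal h (hL hu) (hL hv)
  simpa [sub_eq_zero] using this

/-- Every vector u equals θ(u) x plus an element of the kernel of θ. Inserting this into Φ gives Φ =
β ∧ θ with β = Φ(·, x). -/
lemma congrMod_zero_of_vanishing [IsTopologicalAddGroup V] [ContinuousSMul ℝ V] [T2Space V]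
    [FiniteDimensional ℝ V] {θ : V →L[ℝ] ℝ}
    {Φ : LinearMap.BilinForm ℝ V} (halt : ∀ u v, Φ u v = -Φ v u) {x : V} (hx : θ x = 1)
    (h : ∀ u v, θ u = 0 → θ v = 0 → Φ u v = 0) : CongrMod θ Φ 0 := by
  unfold CongrMod
  have h0 : Φ - 0 = Φ := sub_zero Φ
  rw [h0]
  refine Submodule.subset_span ⟨θ, Submodule.mem_span_singleton_self θ,
    LinearMap.toContinuousLinearMap (Φ.flip x), ?_⟩
  refine LinearMap.ext fun u => LinearMap.ext fun v => ?_
  have hp : ∀ u, θ (u - θ u • x) = 0 := by intro u; simp [hx]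
  have h1 := h _ _ (hp u) (hp v)
  have h2 : Φ x x = 0 := by have := halt x x; linarith
  have h3 := halt x v
  simp only [map_sub, map_smul, LinearMap.sub_apply, LinearMap.smul_apply, smul_eq_mul, h2] at h1
  change Φ u v = Φ u x * θ v - Φ v x * θ u
  rw [h3] at h1
  linarith

end Ideal

/-! ### Sections of pulled back systems -/

section PullSystem

variable {m n : ℕ} {N : Type*} [TopologicalSpace N] [ChartedSpace (EuclideanSpace ℝ (Fin m)) N]
  {M : Type*} [TopologicalSpace M] [ChartedSpace (EuclideanSpace ℝ (Fin n)) M]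

lemma apply_eq_zero_of_mem_pullSystem {f : N → M} {C : ∀ x : M, Submodule ℝ (Cotangent n x)}
    {p : N} {α : Cotangent m p} (hα : α ∈ pullSystem f C p) {v : TangentSpace (𝓡 m) p}
    (hv : mfderiv (𝓡 m) (𝓡 n) f p v = 0) : α v = 0 := by
  obtain ⟨a, -, rfl⟩ := hα
  exact (congrArg a hv).trans (map_zero a)

variable [IsManifold (𝓡 m) ∞ N] [IsManifold (𝓡 n) ∞ M]

/-- Elements of the pullback of a Pfaffian system extend to sections whose exterior derivatives are
annihilated by the vertical vectors. -/
lemma exists_section_of_mem_pullSystem {f : N → M} {p : N} (hf : ContMDiffAt (𝓡 m) (𝓡 n) ∞ f p)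
    {k : ℕ} {C : ∀ x : M, Submodule ℝ (Cotangent n x)} (hC : IsPfaffian k C) {α : Cotangent m p}
    (hα : α ∈ pullSystem f C p) :
    ∃ β : OneForm m N, OneForm.SmoothAt β p ∧ (∀ᶠ q in nhds p, β q ∈ pullSystem f C q) ∧
      β p = α ∧ ∀ u v, mfderiv (𝓡 m) (𝓡 n) f p u = 0 → OneForm.d β p u v = 0 := by
  obtain ⟨a, ha, rfl⟩ := hα
  obtain ⟨U, hU, hpU, η, hsm, hη⟩ := hC (f p)
  have ha' : a ∈ Submodule.span ℝ (Set.range fun i => η i (f p)) := by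
    rw [← (hη _ hpU).2]; exact ha
  obtain ⟨c, hc⟩ := (Submodule.mem_span_range_iff_exists_fun ℝ).1 ha'
  -- Constant coefficients suffice, since only the value at p is prescribed. The derivative of the
  -- pullback of γ is the pullback of dγ, hence killed by vertical vectors.
  let γ : OneForm n M := fun x => ∑ i, c i • η i x
  have hγ : OneForm.SmoothAt γ (f p) :=
    OneForm.smoothAt_sum Finset.univ c fun i _ => hsm i _ hpU
  refine ⟨OneForm.pullback f γ, OneForm.smoothAt_pullback hf hγ, ?_, ?_, ?_⟩
  · filter_upwards [hf.continuousAt.eventually (hU.mem_nhds hpU)] with q hq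
    refine ⟨γ (f q), ?_, rfl⟩
    change γ (f q) ∈ C (f q)
    rw [(hη _ hq).2]
    exact Submodule.sum_mem _ fun i _ => Submodule.smul_mem _ _ (Submodule.subset_span ⟨i, rfl⟩)
  · exact congrArg (pullOne f p) hc
  · intro u v hu
    rw [OneForm.d_pullback hf hγ, hu, map_zero]
    rfl

end PullSystem

section

/-! ### Structure equations of an adapted coframe -/

/-- If the kernel of a surjection from a seven-dimensional to a five-dimensional space lies in the
span of two vectors, then it contains these vectors. -/
lemma map_eq_zero_of_ker_le_span {V V' : Type*} [AddCommGroup V] [Module ℝ V] [AddCommGroup V']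
    [Module ℝ V'] (hV : Module.finrank ℝ V = 7) (hV' : Module.finrank ℝ V' = 5) (f : V →ₗ[ℝ] V')
    (hf : Function.Surjective f) {a b : V} (hab : LinearMap.ker f ≤ Submodule.span ℝ {a, b}) :
    f a = 0 ∧ f b = 0 := by
  have : FiniteDimensional ℝ V := FiniteDimensional.of_finrank_pos (by omega)
  have h1 := f.finrank_range_add_finrank_ker
  rw [LinearMap.range_eq_top.2 hf, finrank_top, hV, hV'] at h1
  have h2 : Module.finrank ℝ (Submodule.span ℝ ({a, b} : Set V)) ≤ 2 := by
    classical
    have := finrank_span_finset_le_card (R := ℝ) ({a, b} : Finset V)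
    push_cast at this
    exact this.trans Finset.card_le_two
  -- The kernel has dimension 7 - 5 = 2, which is already the largest possible dimension of the
  -- span.
  have h3 := Submodule.eq_of_le_of_finrank_le hab (by omega)
  constructor
  · rw [← LinearMap.mem_ker, h3]
    exact Submodule.subset_span (by simp)
  · rw [← LinearMap.mem_ker, h3]
    exact Submodule.subset_span (by simp)

variable {M₁ M₂ P : Type*}
  [TopologicalSpace M₁] [ChartedSpace (EuclideanSpace ℝ (Fin 5)) M₁] [IsManifold (𝓡 5) ∞ M₁]
  [TopologicalSpace M₂] [ChartedSpace (EuclideanSpace ℝ (Fin 5)) M₂] [IsManifold (𝓡 5) ∞ M₂]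
  [TopologicalSpace P] [ChartedSpace (EuclideanSpace ℝ (Fin 7)) P] [IsManifold (𝓡 7) ∞ P]

namespace AdaptedCoframe

variable {T : ParametricBacklund M₁ M₂ P} (σ : AdaptedCoframe T)

/-- The forms of the coframe. -/
def form : Fin 7 → OneForm 7 P := ![σ.ζ, σ.θ₁, σ.θ₂, σ.ω₁, σ.ω₂, σ.ω₃, σ.ω₄]

lemma isMovingFrame : IsMovingFrame σ.dom σ.form σ.frame := ⟨σ.isOpen_dom, σ.smooth, σ.dual⟩

/-- The coefficients in the expansion of the derivatives of the forms of the coframe. -/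
def coeffs (l a b : Fin 7) (q : P) : ℝ := σ.coeff (σ.form l) a b q

lemma coeffs_swap (l a b : Fin 7) (q : P) : σ.coeffs l a b q = -σ.coeffs l b a q :=
  OneForm.d_swap _ _ _ _

lemma coeffs_self (l a : Fin 7) (q : P) : σ.coeffs l a a q = 0 := OneForm.d_self _ _ _

variable {σ} {q : P} (hq : q ∈ σ.dom)

include hq

lemma form_frame (i j : Fin 7) : σ.form i q (σ.frame j q) = if i = j then 1 else 0 :=
  σ.dual q hq i j

lemma expand (v : TangentSpace (𝓡 7) q) :
    v = ∑ j, σ.form j q v • σ.frame j q := (σ.isMovingFrame.sum_smul hq v).symm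

/-- A vertical vector is annihilated by the pullbacks of both characteristic systems. This
determines its ω-components from its ζ-component and leaves two free parameters, the components
along ζ and θ₂; a dimension count shows that all these vectors are vertical. -/
lemma vertical₁ : mfderiv (𝓡 7) (𝓡 5) T.π₁ q (σ.frame 2 q) = 0 ∧
    mfderiv (𝓡 7) (𝓡 5) T.π₁ q
      (σ.frame 0 q - σ.D₄ q • σ.frame 5 q + σ.D₃ q • σ.frame 6 q) = 0 := by
  have hV : Module.finrank ℝ (TangentSpace (𝓡 7) q) = 7 := finrank_euclideanSpace_fin
  have hV' : Module.finrank ℝ (TangentSpace (𝓡 5) (T.π₁ q)) = 5 := finrank_euclideanSpace_fin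
  refine map_eq_zero_of_ker_le_span hV hV'
    (mfderiv (𝓡 7) (𝓡 5) T.π₁ q).toLinearMap
    (fun w => let ⟨v, _, hv⟩ := T.submersion₁ q w; ⟨v, hv⟩) ?_
  intro v hv
  have hv' : mfderiv (𝓡 7) (𝓡 5) T.π₁ q v = 0 := hv
  have h11 : ∀ α ∈ ({σ.θ₁ q, σ.ω₁ q, σ.ω₂ q} : Set (Cotangent 7 q)), α v = 0 := by
    intro α hα
    refine apply_eq_zero_of_mem_pullSystem (f := T.π₁) (C := T.C₁₁) ?_ hv'
    rw [σ.char₁₁ q hq]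
    exact Submodule.subset_span hα
  have h12 : ∀ α ∈ ({σ.θ₁ q, σ.ω₃ q + σ.D₄ q • σ.ζ q, σ.ω₄ q - σ.D₃ q • σ.ζ q} :
      Set (Cotangent 7 q)), α v = 0 := by
    intro α hα
    refine apply_eq_zero_of_mem_pullSystem (f := T.π₁) (C := T.C₁₂) ?_ hv'
    rw [σ.char₁₂ q hq]
    exact Submodule.subset_span hα
  have e1 : σ.form 1 q v = 0 := h11 (σ.θ₁ q) (by simp)
  have e3 : σ.form 3 q v = 0 := h11 (σ.ω₁ q) (by simp)
  have e4 : σ.form 4 q v = 0 := h11 (σ.ω₂ q) (by simp)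
  have e5 : σ.form 5 q v + σ.D₄ q * σ.form 0 q v = 0 :=
    h12 (σ.ω₃ q + σ.D₄ q • σ.ζ q) (by simp)
  have e6 : σ.form 6 q v - σ.D₃ q * σ.form 0 q v = 0 :=
    h12 (σ.ω₄ q - σ.D₃ q • σ.ζ q) (by simp)
  rw [Submodule.mem_span_pair]
  refine ⟨σ.form 2 q v, σ.form 0 q v, ?_⟩
  conv_rhs => rw [expand hq v]
  simp only [Fin.sum_univ_seven, e1, e3, e4, eq_neg_of_add_eq_zero_left e5, eq_of_sub_eq_zero e6]
  module

lemma vertical₂ : mfderiv (𝓡 7) (𝓡 5) T.π₂ q (σ.frame 1 q) = 0 ∧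
    mfderiv (𝓡 7) (𝓡 5) T.π₂ q
      (σ.frame 0 q - σ.D₂ q • σ.frame 3 q + σ.D₁ q • σ.frame 4 q) = 0 := by
  have hV : Module.finrank ℝ (TangentSpace (𝓡 7) q) = 7 := finrank_euclideanSpace_fin
  have hV' : Module.finrank ℝ (TangentSpace (𝓡 5) (T.π₂ q)) = 5 := finrank_euclideanSpace_fin
  refine map_eq_zero_of_ker_le_span hV hV'
    (mfderiv (𝓡 7) (𝓡 5) T.π₂ q).toLinearMap
    (fun w => let ⟨v, _, hv⟩ := T.submersion₂ q w; ⟨v, hv⟩) ?_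
  intro v hv
  have hv' : mfderiv (𝓡 7) (𝓡 5) T.π₂ q v = 0 := hv
  have h22 : ∀ α ∈ ({σ.θ₂ q, σ.ω₃ q, σ.ω₄ q} : Set (Cotangent 7 q)), α v = 0 := by
    intro α hα
    refine apply_eq_zero_of_mem_pullSystem (f := T.π₂) (C := T.C₂₂) ?_ hv'
    rw [σ.char₂₂ q hq]
    exact Submodule.subset_span hα
  have h21 : ∀ α ∈ ({σ.θ₂ q, σ.ω₁ q + σ.D₂ q • σ.ζ q, σ.ω₂ q - σ.D₁ q • σ.ζ q} :
      Set (Cotangent 7 q)), α v = 0 := by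
    intro α hα
    refine apply_eq_zero_of_mem_pullSystem (f := T.π₂) (C := T.C₂₁) ?_ hv'
    rw [σ.char₂₁ q hq]
    exact Submodule.subset_span hα
  have e2 : σ.form 2 q v = 0 := h22 (σ.θ₂ q) (by simp)
  have e5 : σ.form 5 q v = 0 := h22 (σ.ω₃ q) (by simp)
  have e6 : σ.form 6 q v = 0 := h22 (σ.ω₄ q) (by simp)
  have e3 : σ.form 3 q v + σ.D₂ q * σ.form 0 q v = 0 :=
    h21 (σ.ω₁ q + σ.D₂ q • σ.ζ q) (by simp)
  have e4 : σ.form 4 q v - σ.D₁ q * σ.form 0 q v = 0 :=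
    h21 (σ.ω₂ q - σ.D₁ q • σ.ζ q) (by simp)
  rw [Submodule.mem_span_pair]
  refine ⟨σ.form 1 q v, σ.form 0 q v, ?_⟩
  conv_rhs => rw [expand hq v]
  simp only [Fin.sum_univ_seven, e2, e5, e6, eq_neg_of_add_eq_zero_left e3, eq_of_sub_eq_zero e4]
  module

/-- The vertical vectors of the first projection are Cauchy characteristics of the pullback of
`C₁₁`. -/
lemma d_vertical₁ {l : Fin 7} (hl : l = 3 ∨ l = 4) {u v : TangentSpace (𝓡 7) q}
    (hu : mfderiv (𝓡 7) (𝓡 5) T.π₁ q u = 0)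
    (hu' : ∀ i ∈ ({1, 3, 4} : Finset (Fin 7)), σ.form i q u = 0)
    (hv : ∀ i ∈ ({1, 3, 4} : Finset (Fin 7)), σ.form i q v = 0) :
    OneForm.d (σ.form l) q u v = 0 := by
  have hmem : σ.form l q ∈ pullSystem T.π₁ T.C₁₁ q := by
    rw [σ.char₁₁ q hq]
    rcases hl with rfl | rfl <;> exact Submodule.subset_span (by simp [form])
  obtain ⟨β, hβ, hβs, hβq, hβd⟩ := exists_section_of_mem_pullSystem T.smooth_π₁.contMDiffAt
    T.characteristic₁.pfaffian_fst hmem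
  have key := σ.isMovingFrame.d_apply_of_mem_span {1, 3, 4} hq hβ (by
    filter_upwards [hβs, σ.isOpen_dom.mem_nhds hq] with z hz hzd i hi
    rw [σ.char₁₁ z hzd] at hz
    obtain ⟨a, b, c, habc⟩ := Submodule.mem_span_triple.1 hz
    rw [← habc]
    have h1 : σ.θ₁ z (σ.frame i z) = 0 :=
      (form_frame hzd 1 i).trans (if_neg fun h => hi (by simp [← h]))
    have h3 : σ.ω₁ z (σ.frame i z) = 0 :=
      (form_frame hzd 3 i).trans (if_neg fun h => hi (by simp [← h]))
    have h4 : σ.ω₂ z (σ.frame i z) = 0 :=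
      (form_frame hzd 4 i).trans (if_neg fun h => hi (by simp [← h]))
    simp [h1, h3, h4]) hu' hv
  -- At q the section equals the l-th form, so the sum reduces to the derivative of that form.
  rw [hβd u v hu, hβq] at key
  simp only [form_frame hq] at key
  rcases hl with rfl | rfl <;> simpa using key.symm

/-- The vertical vectors of the second projection are Cauchy characteristics of the pullback of
`C₂₁`. -/
lemma d_vertical₂ {l : Fin 7} (hl : l = 3 ∨ l = 4) {u v : TangentSpace (𝓡 7) q}
    (hu : mfderiv (𝓡 7) (𝓡 5) T.π₂ q u = 0)
    (hu' : ∀ i ∈ ({0, 2, 3, 4} : Finset (Fin 7)), σ.form i q u = 0)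
    (hv : ∀ i ∈ ({0, 2, 3, 4} : Finset (Fin 7)), σ.form i q v = 0) :
    OneForm.d (σ.form l) q u v = 0 := by
  -- Only a combination of the l-th form with ζ belongs to the pullback of `C₂₁`. This is why ζ
  -- joins the annihilated forms; its own derivative drops out because dζ ≡ 0 mod ζ.
  have hmem : ∃ k : ℝ, σ.form l q + k • σ.ζ q ∈ pullSystem T.π₂ T.C₂₁ q := by
    rw [σ.char₂₁ q hq]
    rcases hl with rfl | rfl
    · exact ⟨σ.D₂ q, Submodule.subset_span (by simp [form])⟩
    · have h : σ.form 4 q + (-σ.D₁ q) • σ.ζ q = σ.ω₂ q - σ.D₁ q • σ.ζ q := by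
        ext v
        simp [form, sub_eq_add_neg]
      exact ⟨-σ.D₁ q, Submodule.subset_span (by rw [h]; simp)⟩
  obtain ⟨k, hmem⟩ := hmem
  obtain ⟨β, hβ, hβs, hβq, hβd⟩ := exists_section_of_mem_pullSystem T.smooth_π₂.contMDiffAt
    T.characteristic₂.pfaffian_fst hmem
  have key := σ.isMovingFrame.d_apply_of_mem_span {0, 2, 3, 4} hq hβ (by
    filter_upwards [hβs, σ.isOpen_dom.mem_nhds hq] with z hz hzd i hi
    rw [σ.char₂₁ z hzd] at hz
    obtain ⟨a, b, c, habc⟩ := Submodule.mem_span_triple.1 hz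
    rw [← habc]
    have h0 : σ.ζ z (σ.frame i z) = 0 :=
      (form_frame hzd 0 i).trans (if_neg fun h => hi (by simp [← h]))
    have h2 : σ.θ₂ z (σ.frame i z) = 0 :=
      (form_frame hzd 2 i).trans (if_neg fun h => hi (by simp [← h]))
    have h3 : σ.ω₁ z (σ.frame i z) = 0 :=
      (form_frame hzd 3 i).trans (if_neg fun h => hi (by simp [← h]))
    have h4 : σ.ω₂ z (σ.frame i z) = 0 :=
      (form_frame hzd 4 i).trans (if_neg fun h => hi (by simp [← h]))
    simp [h0, h2, h3, h4]) hu' hv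
  have hζ : OneForm.d (σ.form 0) q u v = 0 :=
    (σ.zeta_integrable q hq).apply_eq (hu' 0 (by simp)) (hv 0 (by simp))
  have hval : ∀ i, β q (σ.frame i q) = (if l = i then 1 else 0) + k * if 0 = i then 1 else 0 := by
    intro i
    rw [hβq, ← form_frame hq l i, ← form_frame hq 0 i]
    rfl
  rw [hβd u v hu] at key
  simp only [hval] at key
  rcases hl with rfl | rfl <;> simpa [hζ] using key.symm

lemma d_theta₁ {u v : TangentSpace (𝓡 7) q} (hu : σ.form 1 q u = 0) (hv : σ.form 1 q v = 0) :
    OneForm.d (σ.form 1) q u v = (σ.A₁ q • wedge (σ.form 3 q) (σ.form 4 q) +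
      wedge (σ.form 5 q) (σ.form 6 q) +
      wedge (σ.form 0 q) (σ.D₃ q • σ.form 5 q + σ.D₄ q • σ.form 6 q)) u v :=
  (σ.dtheta₁ q hq).apply_eq hu hv

/-- The components of `dθ₁` on the common kernel of `θ₁`, `ω₁`, `ω₂`. -/
lemma coeffs_theta₁ : σ.coeffs 1 5 6 q = 1 ∧ σ.coeffs 1 2 5 q = 0 ∧ σ.coeffs 1 2 6 q = 0 ∧
    σ.coeffs 1 0 5 q = σ.D₃ q ∧ σ.coeffs 1 0 6 q = σ.D₄ q := by
  have h : ∀ a b : Fin 7, 1 ≠ a → 1 ≠ b → σ.coeffs 1 a b q =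
      (σ.A₁ q • wedge (σ.form 3 q) (σ.form 4 q) + wedge (σ.form 5 q) (σ.form 6 q) +
      wedge (σ.form 0 q) (σ.D₃ q • σ.form 5 q + σ.D₄ q • σ.form 6 q))
        (σ.frame a q) (σ.frame b q) := fun a b ha hb =>
    d_theta₁ hq ((form_frame hq 1 a).trans (if_neg ha)) ((form_frame hq 1 b).trans (if_neg hb))
  refine ⟨?_, ?_, ?_, ?_, ?_⟩ <;> rw [h _ _ (by decide) (by decide)] <;>
    simp [wedge_apply, form_frame hq]

/-- The components of `dω₁` and `dω₂` that vanish by the structure equations. -/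
lemma coeffs_omega {l : Fin 7} (hl : l = 3 ∨ l = 4) :
    σ.coeffs l 0 2 q = 0 ∧ σ.coeffs l 2 5 q = 0 ∧ σ.coeffs l 2 6 q = 0 ∧
    σ.coeffs l 0 5 q = σ.D₃ q * σ.coeffs l 5 6 q ∧ σ.coeffs l 0 6 q = σ.D₄ q * σ.coeffs l 5 6 q ∧
    σ.coeffs l 1 5 q = 0 ∧ σ.coeffs l 1 6 q = 0 := by
  have hann : ∀ (s : Finset (Fin 7)) (a : Fin 7), a ∉ s →
      ∀ i ∈ s, σ.form i q (σ.frame a q) = 0 := fun s a ha i hi =>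
    (form_frame hq i a).trans (if_neg fun h => ha (by rw [← h]; exact hi))
  -- Three vertical directions give all the relations: `frame 2` and the corrected `frame 0` for the
  -- first projection, `frame 1` for the second.
  have h2 : ∀ a : Fin 7, a ∉ ({1, 3, 4} : Finset (Fin 7)) → σ.coeffs l 2 a q = 0 := fun a ha =>
    d_vertical₁ hq hl (vertical₁ hq).1 (hann _ 2 (by decide)) (hann _ a ha)
  have h1 : ∀ a : Fin 7, a ∉ ({0, 2, 3, 4} : Finset (Fin 7)) → σ.coeffs l 1 a q = 0 := fun a ha =>
    d_vertical₂ hq hl (vertical₂ hq).1 (hann _ 1 (by decide)) (hann _ a ha)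
  have h0 : ∀ a : Fin 7, a ∉ ({1, 3, 4} : Finset (Fin 7)) →
      σ.coeffs l 0 a q - σ.D₄ q * σ.coeffs l 5 a q + σ.D₃ q * σ.coeffs l 6 a q = 0 := by
    intro a ha
    have := d_vertical₁ hq hl (vertical₁ hq).2 (fun i hi => by
      simp [hann _ 0 (by decide) i hi, hann _ 5 (by decide) i hi, hann _ 6 (by decide) i hi])
      (hann _ a ha)
    simpa [coeffs, coeff] using this
  have h05 := h0 5 (by decide)
  have h06 := h0 6 (by decide)
  rw [coeffs_self, σ.coeffs_swap l 6 5] at h05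
  rw [coeffs_self] at h06
  refine ⟨?_, h2 5 (by decide), h2 6 (by decide), by linarith, by linarith,
    h1 5 (by decide), h1 6 (by decide)⟩
  rw [σ.coeffs_swap, h2 0 (by decide), neg_zero]

end AdaptedCoframe

end

section

/-! ### The integrable line -/

lemma det_eq_zero_of_not_linearIndependent {X Y : Fin 2 → ℝ}
    (h : ¬ LinearIndependent ℝ ![X, Y]) : X 0 * Y 1 - X 1 * Y 0 = 0 := by
  by_contra hdet
  refine h (LinearIndependent.pair_iff.2 fun s t hst => ?_)
  have h0 : s * X 0 + t * Y 0 = 0 := by simpa using congrFun hst 0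
  have h1 : s * X 1 + t * Y 1 = 0 := by simpa using congrFun hst 1
  constructor
  · refine (mul_eq_zero.1 (?_ : s * (X 0 * Y 1 - X 1 * Y 0) = 0)).resolve_right hdet
    linear_combination Y 1 * h0 - Y 0 * h1
  · refine (mul_eq_zero.1 (?_ : t * (X 0 * Y 1 - X 1 * Y 0) = 0)).resolve_right hdet
    linear_combination X 0 * h1 - X 1 * h0

lemma det_eq_zero_of_perp {D X Y : Fin 2 → ℝ} (hD : D ≠ 0) (hX : D ⬝ᵥ X = 0) (hY : D ⬝ᵥ Y = 0) :
    X 0 * Y 1 - X 1 * Y 0 = 0 := by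
  simp only [dotProduct, Fin.sum_univ_two] at hX hY
  by_contra hdet
  refine hD (funext fun i => ?_)
  fin_cases i
  · refine (mul_eq_zero.1 (?_ : D 0 * (X 0 * Y 1 - X 1 * Y 0) = 0)).resolve_right hdet
    linear_combination Y 1 * hX - X 1 * hY
  · refine (mul_eq_zero.1 (?_ : D 1 * (X 0 * Y 1 - X 1 * Y 0) = 0)).resolve_right hdet
    linear_combination X 0 * hY - Y 0 * hX

/-- Vectors of the plane perpendicular to a nonzero D are parallel; for D = 0 parallelism is part of
the hypothesis. -/
lemma PerpCondition.det_eq_zero {B C D E : Fin 2 → ℝ} (h : PerpCondition B C D E) :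
    B 0 * C 1 - B 1 * C 0 = 0 ∧ B 0 * E 1 - B 1 * E 0 = 0 ∧ C 0 * E 1 - C 1 * E 0 = 0 := by
  by_cases hD : D = 0
  · obtain ⟨h1, h2, h3⟩ := h.dependent hD
    exact ⟨det_eq_zero_of_not_linearIndependent h1, det_eq_zero_of_not_linearIndependent h2,
      det_eq_zero_of_not_linearIndependent h3⟩
  · exact ⟨det_eq_zero_of_perp hD h.perp_B h.perp_C, det_eq_zero_of_perp hD h.perp_B h.perp_E,
      det_eq_zero_of_perp hD h.perp_C h.perp_E⟩

/-- A vector perpendicular to a nonzero vector is perpendicular to its multiples. -/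
lemma perp_of_parallel {x₁ x₂ y₁ y₂ g₁ g₂ : ℝ} (hx : x₁ ≠ 0 ∨ x₂ ≠ 0) (hxy : x₁ * y₂ - x₂ * y₁ = 0)
    (hg : x₁ * g₁ + x₂ * g₂ = 0) : y₁ * g₁ + y₂ * g₂ = 0 := by
  rcases hx with hx | hx
  · refine (mul_eq_zero.1 (?_ : x₁ * (y₁ * g₁ + y₂ * g₂) = 0)).resolve_left hx
    linear_combination y₁ * hg + g₂ * hxy
  · refine (mul_eq_zero.1 (?_ : x₂ * (y₁ * g₁ + y₂ * g₂) = 0)).resolve_left hx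
    linear_combination y₂ * hg - g₁ * hxy

variable {M₁ M₂ P : Type*}
  [TopologicalSpace M₁] [ChartedSpace (EuclideanSpace ℝ (Fin 5)) M₁] [IsManifold (𝓡 5) ∞ M₁]
  [TopologicalSpace M₂] [ChartedSpace (EuclideanSpace ℝ (Fin 5)) M₂] [IsManifold (𝓡 5) ∞ M₂]
  [TopologicalSpace P] [ChartedSpace (EuclideanSpace ℝ (Fin 7)) P] [IsManifold (𝓡 7) ∞ P]

/-- The system spanned by the forms `ω₁`, `ω₂` of the adapted coframes. -/
def ParametricBacklund.commonSystem (T : ParametricBacklund M₁ M₂ P) (p : P) :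
    Submodule ℝ (Cotangent 7 p) :=
  pullSystem T.π₁ T.C₁₁ p ⊓ (pullSystem T.π₂ T.C₂₁ p ⊔ Submodule.span ℝ {dFun (m := 7) T.lam p})

/-- The derived system of the system spanned by `ω₁`, `ω₂`. -/
def ParametricBacklund.derivedSystem (T : ParametricBacklund M₁ M₂ P) (p : P) :
    Submodule ℝ (Cotangent 7 p) :=
  Submodule.span ℝ {α | ∃ β : OneForm 7 P, OneForm.SmoothAt β p ∧
    (∀ᶠ q in nhds p, β q ∈ T.commonSystem q) ∧ β p = α ∧
    ∀ u v, (∀ γ ∈ T.commonSystem p, γ u = 0) → (∀ γ ∈ T.commonSystem p, γ v = 0) →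
      OneForm.d β p u v = 0}

namespace AdaptedCoframe

variable {T : ParametricBacklund M₁ M₂ P} {σ : AdaptedCoframe T}

/-- The form ζ is a nonzero multiple of dλ, so adding dλ to π₂*C₂₁ gives the span of θ₂, ω₁, ω₂, ζ.
It meets the span of θ₁, ω₁, ω₂ exactly in that of ω₁, ω₂. The description by the transformation
alone makes the line independent of the coframe. -/
lemma commonSystem_eq {q : P} (hq : q ∈ σ.dom) :
    T.commonSystem q = Submodule.span ℝ {σ.form 3 q, σ.form 4 q} := by
  have hsurj : ∃ v, dFun (m := 7) T.lam q v = 1 := by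
    obtain ⟨w, hw⟩ := DFunLike.ne_iff.1 (T.dlam_ne_zero q)
    refine ⟨(dFun (m := 7) T.lam q w)⁻¹ • w, ?_⟩
    rw [map_smul]
    exact inv_mul_cancel₀ hw
  obtain ⟨x, hx⟩ := hsurj
  have hζ : σ.form 0 q = σ.form 0 q x • dFun (m := 7) T.lam q := by
    ext v
    have h0 := σ.zeta_slice q hq (v - dFun (m := 7) T.lam q v • x) (by
      rw [map_sub, map_smul, hx]
      exact sub_eq_zero.2 (mul_one _).symm)
    rw [map_sub, map_smul, sub_eq_zero] at h0
    exact h0.trans (mul_comm _ _)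
  have hk : σ.form 0 q x ≠ 0 := by
    intro h0
    have h1 := form_frame hq 0 0
    rw [hζ, h0, zero_smul] at h1
    simp at h1
  have hlam : dFun (m := 7) T.lam q = (σ.form 0 q x)⁻¹ • σ.form 0 q :=
    ((inv_smul_eq_iff₀ hk).2 hζ).symm
  have hspan : Submodule.span ℝ {dFun (m := 7) T.lam q} = Submodule.span ℝ {σ.form 0 q} := by
    refine le_antisymm ?_ ?_
    · rw [Submodule.span_singleton_le_iff_mem, hlam]
      exact Submodule.smul_mem _ _ (Submodule.mem_span_singleton_self _)
    · rw [Submodule.span_singleton_le_iff_mem, hζ]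
      exact Submodule.smul_mem _ _ (Submodule.mem_span_singleton_self _)
  unfold ParametricBacklund.commonSystem
  rw [hspan, σ.char₁₁ q hq, σ.char₂₁ q hq]
  refine le_antisymm ?_ ?_
  · rintro α ⟨h1, h2⟩
    obtain ⟨a, b, c, rfl⟩ := Submodule.mem_span_triple.1 h1
    obtain ⟨β, hβ, γ, hγ, hsum⟩ := Submodule.mem_sup.1 h2
    obtain ⟨a', b', c', rfl⟩ := Submodule.mem_span_triple.1 hβ
    obtain ⟨d', rfl⟩ := Submodule.mem_span_singleton.1 hγ
    -- Evaluation on the vector dual to θ₁ removes the θ₁-component.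
    have h := DFunLike.congr_fun hsum (σ.frame 1 q)
    have hf : ∀ i, σ.form i q (σ.frame 1 q) = if i = 1 then 1 else 0 := fun i => form_frame hq i 1
    have f0 : σ.ζ q (σ.frame 1 q) = 0 := hf 0
    have f1 : σ.θ₁ q (σ.frame 1 q) = 1 := hf 1
    have f2 : σ.θ₂ q (σ.frame 1 q) = 0 := hf 2
    have f3 : σ.ω₁ q (σ.frame 1 q) = 0 := hf 3
    have f4 : σ.ω₂ q (σ.frame 1 q) = 0 := hf 4
    have f0' : σ.form 0 q (σ.frame 1 q) = 0 := hf 0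
    simp [f0, f1, f2, f3, f4, f0'] at h
    rw [Submodule.mem_span_pair]
    refine ⟨b, c, ?_⟩
    rw [← h, zero_smul, zero_add]
    rfl
  · rw [Submodule.span_le]
    rintro α (rfl | rfl)
    · refine ⟨Submodule.subset_span (by simp [form]), Submodule.mem_sup.2
        ⟨_, Submodule.subset_span (Set.mem_insert_of_mem _ (Set.mem_insert _ _)), _,
          Submodule.smul_mem _ (-σ.D₂ q) (Submodule.mem_span_singleton_self _), ?_⟩⟩
      ext v
      simp [form]
    · refine ⟨Submodule.subset_span (by simp [form]), Submodule.mem_sup.2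
        ⟨σ.ω₂ q - σ.D₁ q • σ.ζ q, Submodule.subset_span (by simp), _,
          Submodule.smul_mem _ (σ.D₁ q) (Submodule.mem_span_singleton_self _), ?_⟩⟩
      ext v
      simp [form]

/-- If `x dω₂ - y dω₁` vanishes on three pairs of vectors of the frame, then it vanishes on the
common kernel of `ω₁` and `ω₂`. -/
lemma coeffs_comb_eq_zero {q : P} (hq : q ∈ σ.dom) {x y : ℝ}
    (hB : x * σ.coeffs 4 1 2 q - y * σ.coeffs 3 1 2 q = 0)
    (hC : x * σ.coeffs 4 5 6 q - y * σ.coeffs 3 5 6 q = 0)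
    (hE : x * σ.coeffs 4 0 1 q - y * σ.coeffs 3 0 1 q = 0) :
    ∀ i ∉ ({3, 4} : Finset (Fin 7)), ∀ j ∉ ({3, 4} : Finset (Fin 7)),
      x * σ.coeffs 4 i j q - y * σ.coeffs 3 i j q = 0 := by
  obtain ⟨a1, a2, a3, a4, a5, a6, a7⟩ := coeffs_omega hq (l := 3) (Or.inl rfl)
  obtain ⟨b1, b2, b3, b4, b5, b6, b7⟩ := coeffs_omega hq (l := 4) (Or.inr rfl)
  have h05 : x * σ.coeffs 4 0 5 q - y * σ.coeffs 3 0 5 q = 0 := by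
    rw [a4, b4]; linear_combination σ.D₃ q * hC
  have h06 : x * σ.coeffs 4 0 6 q - y * σ.coeffs 3 0 6 q = 0 := by
    rw [a5, b5]; linear_combination σ.D₄ q * hC
  have hlt : ∀ i ∉ ({3, 4} : Finset (Fin 7)), ∀ j ∉ ({3, 4} : Finset (Fin 7)), i < j →
      x * σ.coeffs 4 i j q - y * σ.coeffs 3 i j q = 0 := by
    intro i hi j hj hij
    fin_cases i <;> fin_cases j <;>
      first
      | exact absurd hij (by decide)
      | exact absurd hi (by decide)
      | exact absurd hj (by decide)
      | assumption
      | simp [a1, a2, a3, a6, a7, b1, b2, b3, b6, b7]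
  intro i hi j hj
  rcases lt_trichotomy i j with h | h | h
  · exact hlt i hi j hj h
  · subst h; simp [coeffs_self]
  · rw [σ.coeffs_swap 4, σ.coeffs_swap 3]
    linear_combination -(hlt j hj i hi h)

/-- The form `ω₃ ∧ ω₄` occurs in `dω₁` or `dω₂` at points of a dense set. -/
lemma not_eventually_coeffs_eq_zero {p : P} (hp : p ∈ σ.dom)
    (hne : σ.coeffs 3 1 2 p ≠ 0 ∨ σ.coeffs 4 1 2 p ≠ 0 ∨ σ.coeffs 3 0 1 p ≠ 0 ∨
      σ.coeffs 4 0 1 p ≠ 0) :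
    ¬ ∀ᶠ q in nhds p, σ.coeffs 3 5 6 q = 0 ∧ σ.coeffs 4 5 6 q = 0 := by
  intro hC
  -- If C vanishes near p, the structure equations give dω ≡ 0 mod θ₁, ω₁, ω₂ near p, so that d(dω)
  -- = 0 can be used on the kernel of these three forms.
  have key : ∀ l, l = 3 ∨ l = 4 → σ.coeffs l 1 2 p = 0 ∧ σ.coeffs l 0 1 p = 0 := by
    intro l hl
    have hvan : ∀ᶠ q in nhds p, ∀ i ∉ ({1, 3, 4} : Finset (Fin 7)),
        ∀ j ∉ ({1, 3, 4} : Finset (Fin 7)), σ.coeffs l i j q = 0 := by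
      filter_upwards [hC, σ.isOpen_dom.mem_nhds hp] with q hq hqd
      obtain ⟨a1, a2, a3, a4, a5, -, -⟩ := coeffs_omega hqd hl
      have a0 : σ.coeffs l 5 6 q = 0 := by rcases hl with rfl | rfl; exacts [hq.1, hq.2]
      rw [a0, mul_zero] at a4 a5
      have hlt : ∀ i ∉ ({1, 3, 4} : Finset (Fin 7)), ∀ j ∉ ({1, 3, 4} : Finset (Fin 7)), i < j →
          σ.coeffs l i j q = 0 := by
        intro i hi j hj hij
        fin_cases i <;> fin_cases j <;>
          first
          | exact absurd hij (by decide)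
          | exact absurd hi (by decide)
          | exact absurd hj (by decide)
          | assumption
      intro i hi j hj
      rcases lt_trichotomy i j with h | h | h
      · exact hlt i hi j hj h
      · subst h; exact coeffs_self _ _ _ _
      · rw [σ.coeffs_swap, hlt j hj i hi h, neg_zero]
    have hann : ∀ a : Fin 7, a ∉ ({1, 3, 4} : Finset (Fin 7)) →
        ∀ i ∈ ({1, 3, 4} : Finset (Fin 7)), σ.form i p (σ.frame a p) = 0 := fun a ha i hi =>
      (form_frame hp i a).trans (if_neg fun h => ha (by rw [← h]; exact hi))
    have hsm : ∀ᶠ q in nhds p, OneForm.SmoothAt (σ.form l) q :=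
      Filter.eventually_of_mem (σ.isOpen_dom.mem_nhds hp) fun q hq => σ.isMovingFrame.smoothAt l hq
    have hcyc : ∀ a : Fin 7, a ∉ ({1, 3, 4} : Finset (Fin 7)) →
        -- For a = 2 and a = 0 the term i = 1 leaves just the coefficient (1, a) of dω, because dθ₁
        -- contains ω₃ ∧ ω₄ with coefficient one and dω has no components (1, 5), (1, 6). The terms
        -- i = 3, 4 vanish, since C = 0 kills the remaining coefficients.
        ∑ i ∈ ({1, 3, 4} : Finset (Fin 7)), (σ.coeffs i 5 6 p * σ.coeffs l i a p +
          σ.coeffs i 6 a p * σ.coeffs l i 5 p + σ.coeffs i a 5 p * σ.coeffs l i 6 p) = 0 :=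
      fun a ha => σ.isMovingFrame.d_cyclic {1, 3, 4} hp hsm hvan (hann 5 (by decide))
        (hann 6 (by decide)) (hann a ha)
    obtain ⟨t1, -, -, -, -⟩ := coeffs_theta₁ hp
    obtain ⟨-, -, -, -, -, c6, c7⟩ := coeffs_omega hp hl
    have hvan3 := fun i (hi : i = 3 ∨ i = 4) => coeffs_omega hp hi
    obtain ⟨a1, a2, a3, a4, a5, -, -⟩ := hvan3 3 (Or.inl rfl)
    obtain ⟨b1, b2, b3, b4, b5, -, -⟩ := hvan3 4 (Or.inr rfl)
    obtain ⟨z1, z2⟩ := hC.self_of_nhds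
    rw [z1, mul_zero] at a4 a5
    rw [z2, mul_zero] at b4 b5
    have h2 := hcyc 2 (by decide)
    have h0 := hcyc 0 (by decide)
    simp [t1, c6, c7, z1, z2, a2, a3, b2, b3, σ.coeffs_swap _ 6 2] at h2
    simp [t1, c6, c7, z1, z2, a4, a5, b4, b5, σ.coeffs_swap _ 6 0] at h0
    exact ⟨h2, by rw [σ.coeffs_swap, h0, neg_zero]⟩
  obtain ⟨k1, k2⟩ := key 3 (Or.inl rfl)
  obtain ⟨k3, k4⟩ := key 4 (Or.inr rfl)
  rcases hne with h | h | h | h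
  exacts [h k1, h k3, h k2, h k4]

end AdaptedCoframe

end

/-! ### Integrability of the perpendicular combination, and gluing of the local lines -/

section

lemma continuousAt_of_contDiffAt_chart {P : Type*} [TopologicalSpace P]
    [ChartedSpace (EuclideanSpace ℝ (Fin 7)) P] {g : P → ℝ} {p : P}
    (hg : ContDiffAt ℝ ∞ (fun y => g ((extChartAt (𝓡 7) p).symm y)) (extChartAt (𝓡 7) p p)) :
    ContinuousAt g p := by
  have h := ContinuousAt.comp (f := extChartAt (𝓡 7) p) (x := p) hg.continuousAt
    (continuousAt_extChartAt p)
  refine h.congr ?_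
  filter_upwards [extChartAt_source_mem_nhds (I := 𝓡 7) p] with q hq
  exact congrArg g ((extChartAt (𝓡 7) p).left_inv hq)

variable {M₁ M₂ P : Type*}
  [TopologicalSpace M₁] [ChartedSpace (EuclideanSpace ℝ (Fin 5)) M₁] [IsManifold (𝓡 5) ∞ M₁]
  [TopologicalSpace M₂] [ChartedSpace (EuclideanSpace ℝ (Fin 5)) M₂] [IsManifold (𝓡 5) ∞ M₂]
  [TopologicalSpace P] [ChartedSpace (EuclideanSpace ℝ (Fin 7)) P] [IsManifold (𝓡 7) ∞ P]

namespace AdaptedCoframe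

variable {T : ParametricBacklund M₁ M₂ P} (σ : AdaptedCoframe T)

lemma contDiffAt_coeffs {q : P} (hq : q ∈ σ.dom) (l a b : Fin 7) :
    ContDiffAt ℝ ∞ (fun y => σ.coeffs l a b ((extChartAt (𝓡 7) q).symm y))
      (extChartAt (𝓡 7) q q) :=
  σ.isMovingFrame.contDiffAt_d_apply hq (σ.smooth l) a b

/-- The combination of `ω₁`, `ω₂` whose coefficients are perpendicular to the coefficients of the
wedge product of the `a`-th and the `b`-th form in `dω₁`, `dω₂`. -/
def perpForm (a b : Fin 7) : OneForm 7 P := fun q =>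
  σ.coeffs 4 a b q • σ.form 3 q + (-σ.coeffs 3 a b q) • σ.form 4 q

lemma smoothOn_perpForm (a b : Fin 7) : OneForm.SmoothOn (σ.perpForm a b) σ.dom := fun _ hq =>
  OneForm.smoothAt_add
    (OneForm.smoothAt_smul (σ.contDiffAt_coeffs hq 4 a b) (σ.isMovingFrame.smoothAt 3 hq))
    (OneForm.smoothAt_smul (σ.contDiffAt_coeffs hq 3 a b).neg (σ.isMovingFrame.smoothAt 4 hq))

lemma perpForm_apply (a b : Fin 7) (q : P) (v : TangentSpace (𝓡 7) q) :
    σ.perpForm a b q v =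
      σ.coeffs 4 a b q * σ.form 3 q v - σ.coeffs 3 a b q * σ.form 4 q v := by
  simp [perpForm, sub_eq_add_neg]

variable {σ}

lemma form_eq_zero_of_notMem {q : P} (hq : q ∈ σ.dom) {s : Finset (Fin 7)} {a : Fin 7}
    (ha : a ∉ s) : ∀ i ∈ s, σ.form i q (σ.frame a q) = 0 := fun i hi =>
  (form_frame hq i a).trans (if_neg fun h => ha (by rw [← h]; exact hi))

/-- The derivative of a section of the span of `ω₁`, `ω₂` on the kernel of these forms. -/
lemma d_section_apply {q : P} (hq : q ∈ σ.dom) {β : OneForm 7 P} (hβ : OneForm.SmoothAt β q)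
    (hspan : ∀ᶠ z in nhds q, β z ∈ Submodule.span ℝ {σ.form 3 z, σ.form 4 z})
    {i j : Fin 7} (hi : i ∉ ({3, 4} : Finset (Fin 7))) (hj : j ∉ ({3, 4} : Finset (Fin 7))) :
    OneForm.d β q (σ.frame i q) (σ.frame j q) =
      β q (σ.frame 3 q) * σ.coeffs 3 i j q + β q (σ.frame 4 q) * σ.coeffs 4 i j q := by
  have := σ.isMovingFrame.d_apply_of_mem_span {3, 4} hq hβ (by
    filter_upwards [hspan, σ.isOpen_dom.mem_nhds hq] with z hz hzd k hk
    obtain ⟨x, y, hxy⟩ := Submodule.mem_span_pair.1 hz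
    have h := form_eq_zero_of_notMem hzd hk
    rw [← hxy]
    simp [h 3 (by simp), h 4 (by simp)])
    (form_eq_zero_of_notMem hq hi) (form_eq_zero_of_notMem hq hj)
  rw [this, Finset.sum_pair (by decide)]
  rfl

lemma perpForm_mem_span (a b : Fin 7) (q : P) :
    σ.perpForm a b q ∈ Submodule.span ℝ {σ.form 3 q, σ.form 4 q} :=
  Submodule.mem_span_pair.2 ⟨_, _, rfl⟩

lemma perpForm_frame {q : P} (hq : q ∈ σ.dom) (a b : Fin 7) :
    σ.perpForm a b q (σ.frame 3 q) = σ.coeffs 4 a b q ∧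
      σ.perpForm a b q (σ.frame 4 q) = -σ.coeffs 3 a b q := by
  simp [perpForm_apply, form_frame hq]

/-- The condition that the coefficients of three wedge products in `dω₁`, `dω₂` are proportional to
those of the wedge product of the `a`-th and the `b`-th form. -/
def Parallel (σ : AdaptedCoframe T) (a b : Fin 7) (q : P) : Prop :=
  ∀ i ∉ ({3, 4} : Finset (Fin 7)), ∀ j ∉ ({3, 4} : Finset (Fin 7)),
    σ.coeffs 3 a b q * σ.coeffs 4 i j q - σ.coeffs 4 a b q * σ.coeffs 3 i j q = 0

variable {a b : Fin 7}

/-- On the kernel of ω₁, ω₂ the coefficients of η are not differentiated, so dη is there y dω₁ - x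
dω₂, whose components are the determinants in `Parallel`. -/
lemma d_perpForm_apply {q : P} (hq : q ∈ σ.dom) (hpar : σ.Parallel a b q)
    {i j : Fin 7} (hi : i ∉ ({3, 4} : Finset (Fin 7))) (hj : j ∉ ({3, 4} : Finset (Fin 7))) :
    OneForm.d (σ.perpForm a b) q (σ.frame i q) (σ.frame j q) = 0 := by
  rw [d_section_apply hq (σ.smoothOn_perpForm a b q hq)
    (Filter.Eventually.of_forall fun z => perpForm_mem_span a b z) hi hj,
    (perpForm_frame hq a b).1, (perpForm_frame hq a b).2]
  linear_combination -(hpar i hi j hj)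

/-- The consequence of `d(dη) = 0` for the form `η = perpForm`. -/
lemma coeffs_dotProduct_d_perpForm {p : P} (hp : p ∈ σ.dom) (hpar : ∀ q ∈ σ.dom, σ.Parallel a b q)
    (hBC : σ.Parallel 1 2 p) (hEC : σ.Parallel 0 1 p)
    (hBE : (σ.coeffs 3 1 2 p ≠ 0 ∨ σ.coeffs 4 1 2 p ≠ 0) ∨
      (σ.coeffs 3 0 1 p ≠ 0 ∨ σ.coeffs 4 0 1 p ≠ 0))
    {j : Fin 7} (hj : j ∉ ({3, 4} : Finset (Fin 7))) :
    σ.coeffs 3 5 6 p * OneForm.d (σ.perpForm a b) p (σ.frame 3 p) (σ.frame j p) +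
      σ.coeffs 4 5 6 p * OneForm.d (σ.perpForm a b) p (σ.frame 4 p) (σ.frame j p) = 0 := by
  have hdom := σ.isOpen_dom.mem_nhds hp
  set g : Fin 7 → Fin 7 → ℝ := fun l k =>
    OneForm.d (σ.perpForm a b) p (σ.frame l p) (σ.frame k p) with hg
  have hcyc : ∀ i ∉ ({3, 4} : Finset (Fin 7)), ∀ k ∉ ({3, 4} : Finset (Fin 7)),
      ∀ m ∉ ({3, 4} : Finset (Fin 7)),
      (σ.coeffs 3 i k p * g 3 m + σ.coeffs 3 k m p * g 3 i + σ.coeffs 3 m i p * g 3 k) +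
      (σ.coeffs 4 i k p * g 4 m + σ.coeffs 4 k m p * g 4 i + σ.coeffs 4 m i p * g 4 k) = 0 := by
    intro i hi k hk m hm
    have := σ.isMovingFrame.d_cyclic {3, 4} hp
      (Filter.eventually_of_mem hdom (σ.smoothOn_perpForm a b))
      (Filter.eventually_of_mem hdom fun q hq i hi j hj => d_perpForm_apply hq (hpar q hq) hi hj)
      (form_eq_zero_of_notMem hp hi) (form_eq_zero_of_notMem hp hk) (form_eq_zero_of_notMem hp hm)
    rw [Finset.sum_pair (by decide)] at this
    exact this
  obtain ⟨a1, a2, a3, a4, a5, a6, a7⟩ := coeffs_omega hp (l := 3) (Or.inl rfl)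
  obtain ⟨b1, b2, b3, b4, b5, b6, b7⟩ := coeffs_omega hp (l := 4) (Or.inr rfl)
  have s := fun l i k => σ.coeffs_swap l i k p
  -- The triples containing 5 and 6 give the product of C with the vectors `g · 1` and `g · 2`
  -- directly, and with `g · 0` up to multiples of the products with `g · 5` and `g · 6`.
  have h1 := hcyc 5 (by decide) 6 (by decide) 1 (by decide)
  rw [s 3 6 1, s 4 6 1, a6, a7, b6, b7] at h1
  have h2 := hcyc 5 (by decide) 6 (by decide) 2 (by decide)
  rw [s 3 6 2, s 4 6 2, a2, a3, b2, b3] at h2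
  have h0 := hcyc 5 (by decide) 6 (by decide) 0 (by decide)
  rw [s 3 6 0, s 4 6 0, a4, a5, b4, b5] at h0
  -- For `g · 5` and `g · 6` the triples (1, 2, ·) or (0, 1, ·) give the product with B or E
  -- instead. Whichever of these is nonzero is parallel to C, so the product with C vanishes too.
  have h56 : σ.coeffs 3 5 6 p * g 3 5 + σ.coeffs 4 5 6 p * g 4 5 = 0 ∧
      σ.coeffs 3 5 6 p * g 3 6 + σ.coeffs 4 5 6 p * g 4 6 = 0 := by
    rcases hBE with hB | hE
    · have k5 := hcyc 1 (by decide) 2 (by decide) 5 (by decide)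
      have k6 := hcyc 1 (by decide) 2 (by decide) 6 (by decide)
      rw [s 3 5 1, s 4 5 1, a2, a6, b2, b6] at k5
      rw [s 3 6 1, s 4 6 1, a3, a7, b3, b7] at k6
      have hpar' := hBC 5 (by decide) 6 (by decide)
      exact ⟨perp_of_parallel hB hpar' (by linarith), perp_of_parallel hB hpar' (by linarith)⟩
    · have k5 := hcyc 0 (by decide) 1 (by decide) 5 (by decide)
      have k6 := hcyc 0 (by decide) 1 (by decide) 6 (by decide)
      rw [s 3 5 0, s 4 5 0, a4, a6, b4, b6] at k5
      rw [s 3 6 0, s 4 6 0, a5, a7, b5, b7] at k6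
      have hpar' := hEC 5 (by decide) 6 (by decide)
      exact ⟨perp_of_parallel hE hpar' (by linear_combination k5 + σ.D₃ p * h1),
        perp_of_parallel hE hpar' (by linear_combination k6 + σ.D₄ p * h1)⟩
  change σ.coeffs 3 5 6 p * g 3 j + σ.coeffs 4 5 6 p * g 4 j = 0
  fin_cases j
  · change σ.coeffs 3 5 6 p * g 3 0 + σ.coeffs 4 5 6 p * g 4 0 = 0
    linear_combination h0 + σ.D₄ p * h56.1 - σ.D₃ p * h56.2
  · change σ.coeffs 3 5 6 p * g 3 1 + σ.coeffs 4 5 6 p * g 4 1 = 0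
    linear_combination h1
  · change σ.coeffs 3 5 6 p * g 3 2 + σ.coeffs 4 5 6 p * g 4 2 = 0
    linear_combination h2
  · exact absurd hj (by decide)
  · exact absurd hj (by decide)
  · exact h56.1
  · exact h56.2

/-- The hypothesis of the theorem, on the domain of the coframe. -/
def SatisfiesPerp (σ : AdaptedCoframe T) : Prop :=
  ∀ q ∈ σ.dom, PerpCondition (σ.vecB₁₂ q) (σ.vecC₁₂ q) (σ.vecD₁₂ q) (σ.vecE₁₂ q)

lemma vec_ne_zero {x y : ℝ} : ![x, y] ≠ 0 ↔ x ≠ 0 ∨ y ≠ 0 := by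
  rw [← not_iff_not]
  push Not
  simp [funext_iff, Fin.forall_fin_two]

lemma SatisfiesPerp.parallel (h : σ.SatisfiesPerp) {q : P} (hq : q ∈ σ.dom) :
    σ.Parallel 1 2 q ∧ σ.Parallel 5 6 q ∧ σ.Parallel 0 1 q := by
  obtain ⟨h1, h2, h3⟩ := (h q hq).det_eq_zero
  change σ.coeffs 3 1 2 q * σ.coeffs 4 5 6 q - σ.coeffs 4 1 2 q * σ.coeffs 3 5 6 q = 0 at h1
  change σ.coeffs 3 1 2 q * σ.coeffs 4 0 1 q - σ.coeffs 4 1 2 q * σ.coeffs 3 0 1 q = 0 at h2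
  change σ.coeffs 3 5 6 q * σ.coeffs 4 0 1 q - σ.coeffs 4 5 6 q * σ.coeffs 3 0 1 q = 0 at h3
  refine ⟨coeffs_comb_eq_zero hq (by ring) h1 h2, coeffs_comb_eq_zero hq ?_ (by ring) h3,
    coeffs_comb_eq_zero hq ?_ ?_ (by ring)⟩
  · linear_combination -h1
  · linear_combination -h2
  · linear_combination -h3

/-- At most one of B, C, E is zero, so B and E do not vanish together. -/
lemma SatisfiesPerp.ne_zero (h : σ.SatisfiesPerp) {q : P} (hq : q ∈ σ.dom) :
    (σ.coeffs 3 1 2 q ≠ 0 ∨ σ.coeffs 4 1 2 q ≠ 0) ∨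
      (σ.coeffs 3 0 1 q ≠ 0 ∨ σ.coeffs 4 0 1 q ≠ 0) := by
  rcases (h q hq).two_ne_zero with h | h | h
  exacts [Or.inl (vec_ne_zero.1 h.1), Or.inl (vec_ne_zero.1 h.1), Or.inr (vec_ne_zero.1 h.2)]

/-- Where C ≠ 0, the relation for C transfers to the parallel vector with indices a, b. Such points
are dense, and the left side is continuous. -/
lemma SatisfiesPerp.d_perpForm_mixed (h : σ.SatisfiesPerp) (hpar : ∀ q ∈ σ.dom, σ.Parallel a b q)
    {p : P} (hp : p ∈ σ.dom) {j : Fin 7} (hj : j ∉ ({3, 4} : Finset (Fin 7))) :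
    σ.coeffs 3 a b p * OneForm.d (σ.perpForm a b) p (σ.frame 3 p) (σ.frame j p) +
      σ.coeffs 4 a b p * OneForm.d (σ.perpForm a b) p (σ.frame 4 p) (σ.frame j p) = 0 := by
  set γ : P → ℝ := fun q =>
    σ.coeffs 3 a b q * OneForm.d (σ.perpForm a b) q (σ.frame 3 q) (σ.frame j q) +
      σ.coeffs 4 a b q * OneForm.d (σ.perpForm a b) q (σ.frame 4 q) (σ.frame j q) with hγ
  have hcont : ContinuousAt γ p := by
    refine continuousAt_of_contDiffAt_chart ?_
    exact ((σ.contDiffAt_coeffs hp 3 a b).mul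
      (σ.isMovingFrame.contDiffAt_d_apply hp (σ.smoothOn_perpForm a b) 3 j)).add
      ((σ.contDiffAt_coeffs hp 4 a b).mul
      (σ.isMovingFrame.contDiffAt_d_apply hp (σ.smoothOn_perpForm a b) 4 j))
  by_contra hne
  have hev : ∀ᶠ q in nhds p, γ q ≠ 0 := hcont.eventually_ne hne
  refine not_eventually_coeffs_eq_zero hp (by simpa only [or_assoc] using h.ne_zero hp) ?_
  filter_upwards [hev, σ.isOpen_dom.mem_nhds hp] with q hq hqd
  by_contra hC
  have hC' : σ.coeffs 3 5 6 q ≠ 0 ∨ σ.coeffs 4 5 6 q ≠ 0 := by tauto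
  obtain ⟨hB, -, hE⟩ := h.parallel hqd
  have h1 := coeffs_dotProduct_d_perpForm hqd hpar hB hE (h.ne_zero hqd) hj
  refine hq (perp_of_parallel hC' ?_ h1)
  linear_combination -(hpar q hqd 5 (by decide) 6 (by decide))

/-- The form `perpForm` is integrable. -/
lemma SatisfiesPerp.congrMod_perpForm (h : σ.SatisfiesPerp)
    (hpar : ∀ q ∈ σ.dom, σ.Parallel a b q) {q : P} (hq : q ∈ σ.dom)
    (hne : σ.coeffs 3 a b q ≠ 0 ∨ σ.coeffs 4 a b q ≠ 0) :
    CongrMod (σ.perpForm a b q) (OneForm.d (σ.perpForm a b) q) 0 := by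
  set x := σ.coeffs 3 a b q with hx
  set y := σ.coeffs 4 a b q with hy
  have hr : x ^ 2 + y ^ 2 ≠ 0 := by
    intro h0
    have h1 : x = 0 := by nlinarith
    have h2 : y = 0 := by nlinarith
    exact hne.elim (· h1) (· h2)
  set r := x ^ 2 + y ^ 2 with hrdef
  have hfin : FiniteDimensional ℝ (TangentSpace (𝓡 7) q) :=
    inferInstanceAs (FiniteDimensional ℝ (EuclideanSpace ℝ (Fin 7)))
  have hT2 : T2Space (TangentSpace (𝓡 7) q) := inferInstanceAs (T2Space (EuclideanSpace ℝ (Fin 7)))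
  have hη : ∀ v, σ.perpForm a b q v = y * σ.form 3 q v - x * σ.form 4 q v :=
    fun v => σ.perpForm_apply a b q v
  have hf := form_frame hq
  refine congrMod_zero_of_vanishing (OneForm.d_swap (σ.perpForm a b) q)
    -- The vector is normalised so that η = y ω₁ - x ω₂ takes the value (y² + x²) / r = 1 on it.
    (x := (y / r) • σ.frame 3 q - (x / r) • σ.frame 4 q) ?_ ?_
  · rw [hη]
    simp [hf]
    field_simp
    rw [hrdef]; ring
  set Φ := OneForm.d (σ.perpForm a b) q with hΦ
  -- the vector of the kernel that is not annihilated by the two forms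
  set Z : TangentSpace (𝓡 7) q := x • σ.frame 3 q + y • σ.frame 4 q with hZ
  have hZ3 : σ.form 3 q Z = x := by simp [hZ, hf]
  have hZ4 : σ.form 4 q Z = y := by simp [hZ, hf]
  -- On the kernel of η the pair (ω₁, ω₂) is a multiple of (x, y); k is that multiple, obtained by
  -- orthogonal projection. So only dη(Z, w) remains beyond the kernel of ω₁, ω₂, and it is given by
  -- `d_perpForm_mixed`.
  have hdec : ∀ v, σ.perpForm a b q v = 0 → ∃ k : ℝ, ∃ w : TangentSpace (𝓡 7) q, v = k • Z + w ∧
      ∀ i ∈ ({3, 4} : Finset (Fin 7)), σ.form i q w = 0 := by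
    intro v hv
    rw [hη] at hv
    set k := (x * σ.form 3 q v + y * σ.form 4 q v) / r
    refine ⟨k, v - k • Z, by abel, ?_⟩
    intro i hi
    rw [Finset.mem_insert, Finset.mem_singleton] at hi
    rcases hi with rfl | rfl
    · rw [map_sub, map_smul, hZ3, smul_eq_mul, sub_eq_zero]
      simp only [k]
      field_simp
      rw [hrdef]; linear_combination y * hv
    · rw [map_sub, map_smul, hZ4, smul_eq_mul, sub_eq_zero]
      simp only [k]
      field_simp
      rw [hrdef]; linear_combination -x * hv
  have hZw : ∀ w, (∀ i ∈ ({3, 4} : Finset (Fin 7)), σ.form i q w = 0) → Φ Z w = 0 := by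
    intro w hw
    rw [expand hq w, map_sum]
    refine Finset.sum_eq_zero fun j _ => ?_
    by_cases hj : j ∈ ({3, 4} : Finset (Fin 7))
    · rw [hw j hj, zero_smul, map_zero]
    · have := h.d_perpForm_mixed hpar hq hj
      rw [map_smul, hZ]
      simp only [map_add, map_smul, LinearMap.add_apply, LinearMap.smul_apply, smul_eq_mul]
      rw [this, mul_zero]
  intro u v hu hv
  obtain ⟨k, w, rfl, hw⟩ := hdec u hu
  obtain ⟨k', w', rfl, hw'⟩ := hdec v hv
  have h1 : Φ w w' = 0 := σ.isMovingFrame.bilin_eq_zero hq {3, 4}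
    (fun i hi j hj => d_perpForm_apply hq (hpar q hq) hi hj) hw hw'
  have h2 : Φ w Z = 0 := by rw [hΦ, OneForm.d_swap, ← hΦ, hZw w hw, neg_zero]
  have h3 : Φ Z Z = 0 := OneForm.d_self _ _ _
  simp only [map_add, map_smul, LinearMap.add_apply, LinearMap.smul_apply, smul_eq_mul, h1, h2, h3,
    hZw w' hw']
  ring

/-- If β = s ω₁ + t ω₂ satisfies dβ ≡ 0 mod ω₁, ω₂ at q, its component (a, b) says that (s, t) is
perpendicular to the nonzero vector with indices a, b. This leaves only multiples of `perpForm`,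
which itself qualifies by `Parallel`. -/
lemma derivedSystem_eq {q : P} (hq : q ∈ σ.dom) (hpar : ∀ q ∈ σ.dom, σ.Parallel a b q)
    (ha : a ∉ ({3, 4} : Finset (Fin 7))) (hb : b ∉ ({3, 4} : Finset (Fin 7)))
    (hne : σ.coeffs 3 a b q ≠ 0 ∨ σ.coeffs 4 a b q ≠ 0) :
    T.derivedSystem q = Submodule.span ℝ {σ.perpForm a b q} := by
  have hS := commonSystem_eq hq
  have hSev : ∀ᶠ z in nhds q, T.commonSystem z = Submodule.span ℝ {σ.form 3 z, σ.form 4 z} :=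
    Filter.eventually_of_mem (σ.isOpen_dom.mem_nhds hq) fun z hz => commonSystem_eq hz
  have hann : ∀ i ∉ ({3, 4} : Finset (Fin 7)), ∀ γ ∈ T.commonSystem q, γ (σ.frame i q) = 0 := by
    intro i hi γ hγ
    rw [hS] at hγ
    obtain ⟨x, y, rfl⟩ := Submodule.mem_span_pair.1 hγ
    have h := form_eq_zero_of_notMem hq hi
    simp [h 3 (by simp), h 4 (by simp)]
  refine le_antisymm (Submodule.span_le.2 ?_) (Submodule.span_le.2 ?_)
  · rintro α ⟨β, hβ, hβS, rfl, hβd⟩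
    have h1 := hβd _ _ (hann a ha) (hann b hb)
    have hspan : ∀ᶠ z in nhds q, β z ∈ Submodule.span ℝ {σ.form 3 z, σ.form 4 z} := by
      filter_upwards [hβS, hSev] with z hz1 hz2
      rwa [← hz2]
    rw [d_section_apply hq hβ hspan ha hb] at h1
    have hmem := hspan.self_of_nhds
    obtain ⟨x, y, hxy⟩ := Submodule.mem_span_pair.1 hmem
    have hx : β q (σ.frame 3 q) = x := by rw [← hxy]; simp [form_frame hq]
    have hy : β q (σ.frame 4 q) = y := by rw [← hxy]; simp [form_frame hq]
    rw [hx, hy] at h1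
    rw [← hxy]
    refine Submodule.mem_span_singleton.2 ?_
    rcases hne with h | h
    · refine ⟨-y / σ.coeffs 3 a b q, ?_⟩
      ext v
      simp only [_root_.smul_apply, _root_.add_apply, perpForm_apply, smul_eq_mul]
      field_simp
      linear_combination -(σ.form 3 q v) * h1
    · refine ⟨x / σ.coeffs 4 a b q, ?_⟩
      ext v
      simp only [_root_.smul_apply, _root_.add_apply, perpForm_apply, smul_eq_mul]
      field_simp
      linear_combination -(σ.form 4 q v) * h1
  · rintro α rfl
    refine Submodule.subset_span ⟨σ.perpForm a b, σ.smoothOn_perpForm a b q hq, ?_, rfl, ?_⟩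
    · filter_upwards [hSev] with z hz
      rw [hz]
      exact perpForm_mem_span a b z
    · intro u v hu hv
      rw [hS] at hu hv
      refine σ.isMovingFrame.bilin_eq_zero hq {3, 4}
        (fun i hi j hj => d_perpForm_apply hq (hpar q hq) hi hj) ?_ ?_
      · intro i hi
        rw [Finset.mem_insert, Finset.mem_singleton] at hi
        rcases hi with rfl | rfl <;> exact hu _ (Submodule.subset_span (by simp))
      · intro i hi
        rw [Finset.mem_insert, Finset.mem_singleton] at hi
        rcases hi with rfl | rfl <;> exact hv _ (Submodule.subset_span (by simp))

/-- The same combination of ω₁ + D₂ ζ and ω₂ - D₁ ζ differs from η by a ζ-term whose coefficient is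
the product of D with the vector with indices a, b. -/
lemma perpForm_mem {q : P} (hq : q ∈ σ.dom)
    (hD : σ.D₁ q * σ.coeffs 3 a b q + σ.D₂ q * σ.coeffs 4 a b q = 0) :
    σ.perpForm a b q ∈ pullSystem T.π₁ T.C₁₁ q ⊓ pullSystem T.π₂ T.C₂₁ q := by
  rw [σ.char₁₁ q hq, σ.char₂₁ q hq]
  constructor
  · refine Submodule.mem_span_triple.2 ⟨0, σ.coeffs 4 a b q, -σ.coeffs 3 a b q, ?_⟩
    rw [zero_smul, zero_add]
    rfl
  · refine Submodule.mem_span_triple.2 ⟨0, σ.coeffs 4 a b q, -σ.coeffs 3 a b q, ?_⟩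
    ext v
    simp only [_root_.smul_apply, _root_.add_apply, _root_.sub_apply, perpForm_apply, smul_eq_mul]
    change _ = σ.coeffs 4 a b q * σ.ω₁ q v - σ.coeffs 3 a b q * σ.ω₂ q v
    linear_combination (σ.ζ q v) * hD

lemma SatisfiesPerp.exists_integrable (h : σ.SatisfiesPerp) {W : Set P} (hW : IsOpen W) {p : P}
    (hp : p ∈ σ.dom) (hpW : p ∈ W) :
    ∃ U : Set P, IsOpen U ∧ p ∈ U ∧ U ⊆ W ∧ ∃ η : OneForm 7 P,
      OneForm.SmoothOn η U ∧ IntegrableOn η U ∧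
        ∀ q ∈ U, η q ≠ 0 ∧ T.derivedSystem q = Submodule.span ℝ {η q} ∧
          η q ∈ pullSystem T.π₁ T.C₁₁ q ⊓ pullSystem T.π₂ T.C₂₁ q := by
  -- The pair (1, 2) selects B and (0, 1) selects E. The choice is made at p and is kept on the open
  -- set where the selected vector does not vanish.
  obtain ⟨a, b, ha, hb, hpar, hne, hD⟩ : ∃ a b : Fin 7, a ∉ ({3, 4} : Finset (Fin 7)) ∧
      b ∉ ({3, 4} : Finset (Fin 7)) ∧ (∀ q ∈ σ.dom, σ.Parallel a b q) ∧
      (σ.coeffs 3 a b p ≠ 0 ∨ σ.coeffs 4 a b p ≠ 0) ∧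
      ∀ q ∈ σ.dom, σ.D₁ q * σ.coeffs 3 a b q + σ.D₂ q * σ.coeffs 4 a b q = 0 := by
    have hB : ∀ q ∈ σ.dom, σ.D₁ q * σ.coeffs 3 1 2 q + σ.D₂ q * σ.coeffs 4 1 2 q = 0 := by
      intro q hq
      have := (h q hq).perp_B
      rw [dotProduct, Fin.sum_univ_two] at this
      exact this
    have hE : ∀ q ∈ σ.dom, σ.D₁ q * σ.coeffs 3 0 1 q + σ.D₂ q * σ.coeffs 4 0 1 q = 0 := by
      intro q hq
      have := (h q hq).perp_E
      rw [dotProduct, Fin.sum_univ_two] at this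
      exact this
    rcases h.ne_zero hp with hne | hne
    · exact ⟨1, 2, by decide, by decide, fun q hq => (h.parallel hq).1, hne, hB⟩
    · exact ⟨0, 1, by decide, by decide, fun q hq => (h.parallel hq).2.2, hne, hE⟩
  have hcont : ∀ l, ∀ q ∈ σ.dom, ContinuousAt (σ.coeffs l a b) q := fun l q hq =>
    continuousAt_of_contDiffAt_chart (σ.contDiffAt_coeffs hq l a b)
  refine ⟨{q | q ∈ σ.dom ∧ q ∈ W ∧ (σ.coeffs 3 a b q ≠ 0 ∨ σ.coeffs 4 a b q ≠ 0)}, ?_,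
    ⟨hp, hpW, hne⟩, fun q hq => hq.2.1, σ.perpForm a b, fun q hq => σ.smoothOn_perpForm a b q hq.1,
    fun q hq => h.congrMod_perpForm hpar hq.1 hq.2.2, fun q hq => ⟨?_, ?_, ?_⟩⟩
  · refine isOpen_iff_mem_nhds.2 fun q hq => ?_
    have h3 : ∀ᶠ z in nhds q, σ.coeffs 3 a b z ≠ 0 ∨ σ.coeffs 4 a b z ≠ 0 := by
      rcases hq.2.2 with h | h
      · exact ((hcont 3 q hq.1).eventually_ne h).mono fun z hz => Or.inl hz
      · exact ((hcont 4 q hq.1).eventually_ne h).mono fun z hz => Or.inr hz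
    filter_upwards [σ.isOpen_dom.mem_nhds hq.1, hW.mem_nhds hq.2.1, h3] with z h1 h2 h3
    exact ⟨h1, h2, h3⟩
  · intro h0
    obtain ⟨h3, h4⟩ := perpForm_frame hq.1 a b
    rw [h0] at h3 h4
    rcases hq.2.2 with h | h
    · exact h (neg_eq_zero.1 h4.symm)
    · exact h h3.symm
  · exact derivedSystem_eq hq.1 hpar ha hb hq.2.2
  · exact perpForm_mem hq.1 (hD q hq.1)

end AdaptedCoframe

/-- If every point has a neighbourhood with an adapted coframe that satisfies the perpendicularity
condition, then the derived system of the span of `ω₁`, `ω₂` is an integrable line. -/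
lemma ParametricBacklund.containsIntegrableLine (T : ParametricBacklund M₁ M₂ P) {W : Set P}
    (hW : IsOpen W)
    (h : ∀ p ∈ W, ∃ σ : AdaptedCoframe T, p ∈ σ.dom ∧ σ.SatisfiesPerp) :
    ContainsIntegrableLine (n := 7)
      (fun p : P => pullSystem T.π₁ T.C₁₁ p ⊓ pullSystem T.π₂ T.C₂₁ p) W := by
  refine ⟨T.derivedSystem, fun p hp => ?_, fun p hp => ?_⟩
  · obtain ⟨σ, hσ, hperp⟩ := h p hp
    obtain ⟨U, -, hpU, -, η, -, -, hη⟩ := hperp.exists_integrable hW hσ hp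
    rw [(hη p hpU).2.1, Submodule.span_singleton_le_iff_mem]
    exact (hη p hpU).2.2
  · obtain ⟨σ, hσ, hperp⟩ := h p hp
    obtain ⟨U, hU, hpU, hUW, η, hs, hi, hη⟩ := hperp.exists_integrable hW hσ hp
    exact ⟨U, hU, hpU, hUW, η, hs, hi, fun q hq => ⟨(hη q hq).1, (hη q hq).2.1⟩⟩

end

section

/-! ### Interchanging the two systems -/

lemma linearIndependent_pair_swap {V : Type*} [AddCommMonoid V] [Module ℝ V] {x y : V}
    (h : LinearIndependent ℝ ![x, y]) : LinearIndependent ℝ ![y, x] := by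
  have := h.comp (Equiv.swap 0 1) (Equiv.injective _)
  convert this using 1
  funext i
  fin_cases i <;> rfl

lemma MongeAmpereSystem.IsCharacteristicPair.symm {M : Type*} [TopologicalSpace M]
    [ChartedSpace (EuclideanSpace ℝ (Fin 5)) M] {I : MongeAmpereSystem M}
    {C₁ C₂ : ∀ p : M, Submodule ℝ (Cotangent 5 p)} (h : I.IsCharacteristicPair C₁ C₂) :
    I.IsCharacteristicPair C₂ C₁ :=
  ⟨h.pfaffian_snd, h.pfaffian_fst, h.characteristic_snd, h.characteristic_fst,
    fun p => (h.distinct p).symm⟩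

variable {M₁ M₂ P : Type*}
  [TopologicalSpace M₁] [ChartedSpace (EuclideanSpace ℝ (Fin 5)) M₁] [IsManifold (𝓡 5) ∞ M₁]
  [TopologicalSpace M₂] [ChartedSpace (EuclideanSpace ℝ (Fin 5)) M₂] [IsManifold (𝓡 5) ∞ M₂]
  [TopologicalSpace P] [ChartedSpace (EuclideanSpace ℝ (Fin 7)) P] [IsManifold (𝓡 7) ∞ P]

/-- The transformation with the two Monge-Ampère systems and the numbering of the characteristic
systems interchanged. -/
def ParametricBacklund.swap (T : ParametricBacklund M₁ M₂ P) : ParametricBacklund M₂ M₁ P where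
  I₁ := T.I₂
  I₂ := T.I₁
  hyperbolic₁ := T.hyperbolic₂
  hyperbolic₂ := T.hyperbolic₁
  C₁₁ := T.C₂₂
  C₁₂ := T.C₂₁
  C₂₁ := T.C₁₂
  C₂₂ := T.C₁₁
  characteristic₁ := T.characteristic₂.symm
  characteristic₂ := T.characteristic₁.symm
  π₁ := T.π₂
  π₂ := T.π₁
  lam := T.lam
  smooth_π₁ := T.smooth_π₂
  smooth_π₂ := T.smooth_π₁
  smooth_lam := T.smooth_lam
  isEmbedding := by
    let e : M₁ × M₂ × ℝ ≃ₜ M₂ × M₁ × ℝ :=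
      { toFun := fun x => (x.2.1, x.1, x.2.2)
        invFun := fun x => (x.2.1, x.1, x.2.2)
        left_inv := fun _ => rfl
        right_inv := fun _ => rfl
        continuous_toFun := by fun_prop
        continuous_invFun := by fun_prop }
    exact e.isEmbedding.comp T.isEmbedding
  immersion p v h₁ h₂ h := T.immersion p v h₂ h₁ h
  dlam_ne_zero := T.dlam_ne_zero
  submersion₁ := T.submersion₂
  submersion₂ := T.submersion₁
  backlund p := by
    obtain ⟨U₁, θ₁, Ψ₁, U₂, θ₂, Ψ₂, hU₁, hp₁, hg₁, hU₂, hp₂, hg₂, H, hH, hspan, hli⟩ := T.backlund p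
    refine ⟨U₂, θ₂, Ψ₂, U₁, θ₁, Ψ₁, hU₂, hp₂, hg₂, hU₁, hp₁, hg₁, H, fun v => ?_, ?_,
      linearIndependent_pair_swap hli⟩
    · rw [hH v, and_comm (a := pullOne T.π₁ p (θ₁ (T.π₁ p)) v = 0)]
    · rw [Set.pair_comm, hspan, Set.pair_comm]
  numbering_fst p := by
    rw [sup_comm (pullSystem T.π₂ T.I₂.one p)]
    exact (T.numbering_snd p).symm
  numbering_snd p := by
    rw [sup_comm (pullSystem T.π₂ T.I₂.one p)]
    exact (T.numbering_fst p).symm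

/-- An adapted coframe as an adapted coframe of the transformation with the two systems
interchanged. -/
def AdaptedCoframe.swap {T : ParametricBacklund M₁ M₂ P} (σ : AdaptedCoframe T) :
    AdaptedCoframe T.swap where
  dom := σ.dom
  isOpen_dom := σ.isOpen_dom
  ζ := σ.ζ
  θ₁ := σ.θ₂
  θ₂ := σ.θ₁
  ω₁ := σ.ω₃
  ω₂ := σ.ω₄
  ω₃ := σ.ω₁
  ω₄ := σ.ω₂
  smooth i := by
    fin_cases i
    exacts [σ.smooth 0, σ.smooth 2, σ.smooth 1, σ.smooth 5, σ.smooth 6, σ.smooth 3, σ.smooth 4]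
  frame i := σ.frame (![0, 2, 1, 5, 6, 3, 4] i)
  dual q hq i j := by
    have h : ∀ i : Fin 7, ![σ.ζ, σ.θ₂, σ.θ₁, σ.ω₃, σ.ω₄, σ.ω₁, σ.ω₂] i =
        ![σ.ζ, σ.θ₁, σ.θ₂, σ.ω₁, σ.ω₂, σ.ω₃, σ.ω₄] (![0, 2, 1, 5, 6, 3, 4] i) := by
      intro i
      fin_cases i <;> rfl
    rw [h, σ.dual q hq]
    exact if_congr (by revert i j; decide) rfl rfl
  A₁ := σ.A₂
  A₂ := σ.A₁
  D₁ := σ.D₃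
  D₂ := σ.D₄
  D₃ := σ.D₁
  D₄ := σ.D₂
  zeta_slice := σ.zeta_slice
  zeta_integrable := σ.zeta_integrable
  theta₁_contact := σ.theta₂_contact
  theta₂_contact := σ.theta₁_contact
  char₁₁ := σ.char₂₂
  char₂₂ := σ.char₁₁
  char₁₂ := σ.char₂₁
  char₂₁ := σ.char₁₂
  dtheta₁ q hq := by
    rw [add_comm (σ.A₂ q • _)]
    exact σ.dtheta₂ q hq
  dtheta₂ q hq := by
    rw [add_comm (wedge (σ.ω₃ q) (σ.ω₄ q))]
    exact σ.dtheta₁ q hq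
  A_mul_ne_one q hq := by
    rw [mul_comm]
    exact σ.A_mul_ne_one q hq

lemma not_linearIndependent_neg_left {X Y : Fin 2 → ℝ} (h : ¬ LinearIndependent ℝ ![X, Y]) :
    ¬ LinearIndependent ℝ ![-X, Y] := by
  rw [LinearIndependent.pair_iff] at h ⊢
  intro h'
  refine h fun s t hst => ?_
  obtain ⟨hs, ht⟩ := h' (-s) t (by rw [← hst]; simp)
  exact ⟨neg_eq_zero.1 hs, ht⟩

/-- Interchanging the systems interchanges θ₁ and θ₂, so the coefficients of θ₁ ∧ θ₂ change sign
while C, D, E are merely renumbered. -/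
lemma PerpCondition.neg_left {B C D E : Fin 2 → ℝ} (h : PerpCondition B C D E) :
    PerpCondition (-B) C D E where
  perp_B := by rw [dotProduct_neg, h.perp_B, neg_zero]
  perp_C := h.perp_C
  perp_E := h.perp_E
  two_ne_zero := by simpa only [ne_eq, neg_eq_zero] using h.two_ne_zero
  dependent hD :=
    ⟨not_linearIndependent_neg_left (h.dependent hD).1,
      not_linearIndependent_neg_left (h.dependent hD).2.1, (h.dependent hD).2.2⟩

lemma AdaptedCoframe.satisfiesPerp_swap {T : ParametricBacklund M₁ M₂ P} (σ : AdaptedCoframe T)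
    (h : ∀ q ∈ σ.dom, PerpCondition (σ.vecB₃₄ q) (σ.vecC₃₄ q) (σ.vecD₃₄ q) (σ.vecE₃₄ q)) :
    σ.swap.SatisfiesPerp := by
  intro q hq
  have hB : σ.swap.vecB₁₂ q = -σ.vecB₃₄ q := by
    funext i
    fin_cases i <;> exact OneForm.d_swap _ _ _ _
  rw [hB]
  exact (h q hq).neg_left

end

end Backlund

end

theorem mainTheorem2 {M₁ M₂ P : Type*}
    [TopologicalSpace M₁] [ChartedSpace (EuclideanSpace ℝ (Fin 5)) M₁] [IsManifold (𝓡 5) ∞ M₁]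
    [TopologicalSpace M₂] [ChartedSpace (EuclideanSpace ℝ (Fin 5)) M₂] [IsManifold (𝓡 5) ∞ M₂]
    [TopologicalSpace P] [ChartedSpace (EuclideanSpace ℝ (Fin 7)) P] [IsManifold (𝓡 7) ∞ P]
    (T : Backlund.ParametricBacklund M₁ M₂ P) (W : Set P) (hW : IsOpen W) :
    ((∀ p ∈ W, ∃ σ : Backlund.AdaptedCoframe T, p ∈ σ.dom ∧
        ∀ q ∈ σ.dom, Backlund.PerpCondition (σ.vecB₁₂ q) (σ.vecC₁₂ q) (σ.vecD₁₂ q) (σ.vecE₁₂ q)) →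
      Backlund.ContainsIntegrableLine (n := 7)
        (fun p : P => Backlund.pullSystem T.π₁ T.C₁₁ p ⊓ Backlund.pullSystem T.π₂ T.C₂₁ p) W) ∧
    ((∀ p ∈ W, ∃ σ : Backlund.AdaptedCoframe T, p ∈ σ.dom ∧
        ∀ q ∈ σ.dom, Backlund.PerpCondition (σ.vecB₃₄ q) (σ.vecC₃₄ q) (σ.vecD₃₄ q) (σ.vecE₃₄ q)) →
      Backlund.ContainsIntegrableLine (n := 7)
        (fun p : P => Backlund.pullSystem T.π₁ T.C₁₂ p ⊓ Backlund.pullSystem T.π₂ T.C₂₂ p) W) := by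
  refine ⟨fun h => T.containsIntegrableLine hW h, fun h => ?_⟩
  have hcomm :
      (fun p : P =>
        Backlund.pullSystem (m := 7) (n := 5) T.π₁ T.C₁₂ p ⊓
          Backlund.pullSystem (m := 7) (n := 5) T.π₂ T.C₂₂ p) =
      fun p : P =>
        Backlund.pullSystem (m := 7) (n := 5) T.π₂ T.C₂₂ p ⊓
          Backlund.pullSystem (m := 7) (n := 5) T.π₁ T.C₁₂ p :=
    funext fun p => inf_comm _ _
  rw [hcomm]
  exact T.swap.containsIntegrableLine hW fun p hp =>
    let ⟨σ, hσ, hperp⟩ := h p hp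
    ⟨σ.swap, hσ, σ.satisfiesPerp_swap hperp⟩
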